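/- Notation. Let $k$ be a field and let $S\subset\mathbb{P}^3$ be a smooth cubic surface over $k$, given by a homogeneous cubic form with coefficients in $k$. Let $G_S(k)=\bigoplus_{P\in S(k)}\mathbb{Z}\cdot P$ be the free abelian group on the $k$-rational points of $S$, with degree map $\deg(\sum a_iP_i)=\sum a_i$. Let $G'_S(k)\subseteq G_S(k)$ be the subgroup generated by all sums $P+Q+R$ with $P,Q,R\in S(k)$ such that either (i) there is a line $\ell$ defined over $k$, not contained in $S$, with $\ell\cdot S=P+Q+R$ (intersection points counted with multiplicity), or (ii) there is a line $\ell$ defined over $k$, contained in $S$, with $P,Q,R\in\ell$. Put $G''_S(k)=\{D\in G'_S(k):\deg D=0\}$ and $H_S(k)=G_S(k)/G''_S(k)$. The degree map descends to $H_S(k)$; put $H^0_S(k)=\{D\in H_S(k):\deg D=0\}$. For an extension $L/k$ of fields, the inclusion $S(k)\subseteq S(L)$ induces a homomorphism $H^0_S(k)\to H^0_S(L)$. Theorem. Let $K$ be a number field, $\Omega$ its set of places, and $S\subset\mathbb{P}^3$ a smooth cubic surface over $K$ with $S(\mathbb{A}_K)\neq\emptyset$, where $\mathbb{A}_K$ denotes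 the adèles of $K$. Let $\Sigma$ be a (not necessarily finite) subset of $\Omega$, and let $\mathbb{A}_K^\Sigma$ denote the adèles of $K$ with the $\Sigma$-components removed. Suppose that the image of $S(K)$ in $S(\mathbb{A}_K^\Sigma)$ is dense for the adelic topology. Let $\Delta$ be a finite subset of $\Omega\setminus\Sigma$. Then the diagonal map \[ H^0_S(K)\longrightarrow\prod_{\upsilon\in\Delta}H^0_S(K_\upsilon) \] is surjective. -/

import Mathlib

open scoped LinearAlgebra.Projectivization RestrictedProduct
open MvPolynomial

noncomputable section

/-- A cubic form in four variables over a field `K`; it is the datum of a cubic surface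
`S ⊂ ℙ³` over `K` together with its equation. -/
structure CubicForm (K : Type*) [Field K] where
  /-- the defining polynomial -/
  poly : MvPolynomial (Fin 4) K
  /-- it is homogeneous of degree three -/
  isHomogeneous : poly.IsHomogeneous 3

namespace CubicForm

section Basic

variable {K : Type*} [Field K] (S : CubicForm K)

/-- The surface is smooth: at no geometric point do the form and all its partial
derivatives vanish (in particular the form is not zero). -/
def IsSmooth : Prop :=
  ∀ x : Fin 4 → AlgebraicClosure K, x ≠ 0 → aeval x S.poly = 0 →
    ∃ i, aeval x (pderiv i S.poly) ≠ 0

/-- The set `S(K)` of `K`-rational points: the points of `ℙ³(K)` at which the form vanishes. -/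
def Points : Type _ :=
  {P : ℙ K (Fin 4 → K) // ∀ x ∈ P.submodule, eval x S.poly = 0}

theorem eval_smul (t : K) (x : Fin 4 → K) : eval (t • x) S.poly = t ^ 3 * eval x S.poly := by
  rw [eval_eq, eval_eq, Finset.mul_sum]
  refine Finset.sum_congr rfl fun d hd => ?_
  have h3 : ∑ i ∈ d.support, d i = 3 := by
    have := S.isHomogeneous.degree_eq_sum_deg_support hd
    exact this.symm
  simp only [Pi.smul_apply, smul_eq_mul, mul_pow, Finset.prod_mul_distrib,
    Finset.prod_pow_eq_pow_sum, h3]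
  ring

/-- The restriction of the form to the line through `p` and `q`, as a binary form in the
parameters `(s : t)` of the point `s p + t q`. -/
def restrict (p q : Fin 4 → K) : MvPolynomial (Fin 2) K :=
  aeval (fun i => C (p i) * X 0 + C (q i) * X 1) S.poly

variable {S} in
/-- The point `P` lies on the line through `p` and `q` and has parameter `(a 0 : a 1)` there. -/
def Points.HasParam (P : S.Points) (p q : Fin 4 → K) (a : Fin 2 → K) : Prop :=
  P.1.submodule = K ∙ (a 0 • p + a 1 • q)

/-- The linear form on the projective line that vanishes (to order one) exactly at
`(a 0 : a 1)`. -/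
def vanishAt (a : Fin 2 → K) : MvPolynomial (Fin 2) K :=
  C (a 1) * X 0 - C (a 0) * X 1

variable {S} in
/-- There is a `K`-line `ℓ`, not contained in `S`, with `ℓ · S = P + Q + R`: the
restriction of the form to `ℓ` is nonzero and its divisor of zeros, counted with
multiplicity, is `P + Q + R`. -/
def IsLineSection (P Q R : S.Points) : Prop :=
  ∃ p q : Fin 4 → K, LinearIndependent K ![p, q] ∧
    ∃ a b c : Fin 2 → K, P.HasParam p q a ∧ Q.HasParam p q b ∧ R.HasParam p q c ∧
      ∃ u : K, u ≠ 0 ∧ S.restrict p q = C u * (vanishAt a * vanishAt b * vanishAt c)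

variable {S} in
/-- There is a `K`-line contained in `S` on which `P`, `Q`, `R` lie. -/
def OnContainedLine (P Q R : S.Points) : Prop :=
  ∃ p q : Fin 4 → K, LinearIndependent K ![p, q] ∧ S.restrict p q = 0 ∧
    ∃ a b c : Fin 2 → K, P.HasParam p q a ∧ Q.HasParam p q b ∧ R.HasParam p q c

/-- The free abelian group `G_S(K)` on the `K`-rational points. -/
abbrev G : Type _ := S.Points →₀ ℤ

/-- The degree map `G_S(K) → ℤ`. -/
def degG : S.G →+ ℤ := Finsupp.liftAddHom fun _ => AddMonoidHom.id ℤ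

/-- The subgroup `G'_S(K)` generated by the three point sums. -/
def G' : AddSubgroup S.G :=
  AddSubgroup.closure {D | ∃ P Q R : S.Points, (IsLineSection P Q R ∨ OnContainedLine P Q R) ∧
    D = Finsupp.single P 1 + Finsupp.single Q 1 + Finsupp.single R 1}

/-- The subgroup `G''_S(K)` of the elements of degree zero in `G'_S(K)`. -/
def G'' : AddSubgroup S.G := S.G' ⊓ S.degG.ker

/-- The group `H_S(K) = G_S(K) / G''_S(K)`. -/
abbrev H : Type _ := S.G ⧸ S.G''

/-- The degree map `H_S(K) → ℤ`. -/
def deg : S.H →+ ℤ := QuotientAddGroup.lift S.G'' S.degG fun _ h => h.2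

/-- The degree zero part `H⁰_S(K)` of `H_S(K)`. -/
def H0 : AddSubgroup S.H := S.deg.ker

end Basic

section BaseChange

variable {K : Type*} [Field K] (S : CubicForm K) (L : Type*) [Field L] [Algebra K L]

/-- The same surface over an extension field `L`. -/
def baseChange : CubicForm L where
  poly := S.poly.map (algebraMap K L)
  isHomogeneous := S.isHomogeneous.map _

/-- The coordinatewise embedding `K⁴ → L⁴`. -/
def coordMap (K : Type*) [Field K] (L : Type*) [Field L] [Algebra K L] :
    (Fin 4 → K) →ₛₗ[algebraMap K L] (Fin 4 → L) where
  toFun x i := algebraMap K L (x i)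
  map_add' x y := by ext i; simp
  map_smul' c x := by ext i; simp

theorem coordMap_apply (x : Fin 4 → K) (i : Fin 4) :
    coordMap K L x i = algebraMap K L (x i) := rfl

theorem coordMap_injective : Function.Injective (coordMap K L) := fun x y h => by
  ext i
  exact (algebraMap K L).injective (congrFun h i)

/-- The inclusion `S(K) → S(L)`. -/
def mapPoints (P : S.Points) : (S.baseChange L).Points :=
  ⟨Projectivization.map (coordMap K L) (coordMap_injective L) P.1, by
    obtain ⟨P, hP⟩ := P
    induction P using Projectivization.ind with
    | h v hv =>
      intro x hx
      rw [Projectivization.map_mk, Projectivization.submodule_mk,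
        Submodule.mem_span_singleton] at hx
      obtain ⟨t, rfl⟩ := hx
      have h0 : eval v S.poly = 0 := hP v (by simp)
      have h1 : eval (coordMap K L v) (S.baseChange L).poly = 0 := by
        change eval (fun i => algebraMap K L (v i)) (map (algebraMap K L) S.poly) = _
        rw [← Function.comp_def, ← map_eval, h0, map_zero]
      rw [eval_smul, h1, mul_zero]⟩

theorem mapPoints_hasParam {P : S.Points} {p q : Fin 4 → K} {a : Fin 2 → K}
    (h : P.HasParam p q a) :
    (S.mapPoints L P).HasParam (coordMap K L p) (coordMap K L q)
      (fun i => algebraMap K L (a i)) := by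
  obtain ⟨P, hP⟩ := P
  induction P using Projectivization.ind with
  | h v hv =>
    unfold Points.HasParam at h ⊢
    change (Projectivization.map (coordMap K L) (coordMap_injective L)
      (Projectivization.mk K v hv)).submodule = _
    rw [Projectivization.map_mk, Projectivization.submodule_mk]
    change Submodule.span K {v} = _ at h
    rw [Submodule.span_singleton_eq_span_singleton] at h ⊢
    obtain ⟨u, hu⟩ := h
    refine ⟨Units.map (algebraMap K L).toMonoidHom u, ?_⟩
    ext i
    have := congrArg (algebraMap K L) (congrFun hu i)
    simpa [Units.smul_def, coordMap_apply, Algebra.smul_def] using this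

theorem restrict_baseChange (p q : Fin 4 → K) :
    (S.baseChange L).restrict (coordMap K L p) (coordMap K L q)
      = map (algebraMap K L) (S.restrict p q) := by
  unfold restrict baseChange
  simp only [coordMap_apply]
  induction S.poly using MvPolynomial.induction_on with
  | C a => simp
  | add f g hf hg => simp only [map_add, hf, hg]
  | mul_X f i hf => simp only [map_mul, hf, map_X, aeval_X, map_add, map_C]

theorem linearIndependent_coordMap {p q : Fin 4 → K} (h : LinearIndependent K ![p, q]) :
    LinearIndependent L ![coordMap K L p, coordMap K L q] := by
  have hp : p ≠ 0 := by simpa using h.ne_zero 0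
  have hp' : coordMap K L p ≠ 0 := fun h0 =>
    hp (coordMap_injective L (by rw [h0, map_zero]))
  rw [LinearIndependent.pair_iff' hp] at h
  rw [LinearIndependent.pair_iff' hp']
  intro a ha
  obtain ⟨i, hi⟩ := Function.ne_iff.1 hp
  have hi' : algebraMap K L (p i) ≠ 0 := by simpa using hi
  have hai : a = algebraMap K L (q i / p i) := by
    have := congrFun ha i
    simp only [Pi.smul_apply, smul_eq_mul, coordMap_apply] at this
    rw [map_div₀, ← this]
    field_simp
  apply h (q i / p i)
  apply coordMap_injective L
  rw [LinearMap.map_smulₛₗ, ← hai, ha]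

theorem mapPoints_isLineSection {P Q R : S.Points} (h : IsLineSection P Q R) :
    IsLineSection (S.mapPoints L P) (S.mapPoints L Q) (S.mapPoints L R) := by
  obtain ⟨p, q, hpq, a, b, c, ha, hb, hc, u, hu, e⟩ := h
  refine ⟨_, _, linearIndependent_coordMap L hpq, _, _, _, S.mapPoints_hasParam L ha,
    S.mapPoints_hasParam L hb, S.mapPoints_hasParam L hc, algebraMap K L u, by simpa using hu, ?_⟩
  rw [restrict_baseChange, e]
  simp [vanishAt]

theorem mapPoints_onContainedLine {P Q R : S.Points} (h : OnContainedLine P Q R) :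
    OnContainedLine (S.mapPoints L P) (S.mapPoints L Q) (S.mapPoints L R) := by
  obtain ⟨p, q, hpq, e, a, b, c, ha, hb, hc⟩ := h
  refine ⟨_, _, linearIndependent_coordMap L hpq, ?_, _, _, _, S.mapPoints_hasParam L ha,
    S.mapPoints_hasParam L hb, S.mapPoints_hasParam L hc⟩
  rw [restrict_baseChange, e, map_zero]

/-- The homomorphism `G_S(K) → G_S(L)`. -/
def mapG : S.G →+ (S.baseChange L).G := Finsupp.mapDomain.addMonoidHom (S.mapPoints L)

theorem mapG_single (P : S.Points) (n : ℤ) :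
    S.mapG L (Finsupp.single P n) = Finsupp.single (S.mapPoints L P) n :=
  Finsupp.mapDomain_single

theorem degG_mapG (D : S.G) : (S.baseChange L).degG (S.mapG L D) = S.degG D := by
  have : (S.baseChange L).degG.comp (S.mapG L) = S.degG := by
    ext P
    simp [degG, mapG_single]
  exact DFunLike.congr_fun this D

theorem mapG_mem_G' {D : S.G} (h : D ∈ S.G') : S.mapG L D ∈ (S.baseChange L).G' := by
  have : S.G' ≤ (S.baseChange L).G'.comap (S.mapG L) := by
    refine (AddSubgroup.closure_le _).2 ?_
    rintro _ ⟨P, Q, R, h, rfl⟩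
    refine AddSubgroup.subset_closure ⟨S.mapPoints L P, S.mapPoints L Q, S.mapPoints L R,
      h.imp (S.mapPoints_isLineSection L) (S.mapPoints_onContainedLine L), ?_⟩
    simp only [map_add, mapG_single]
  exact this h

theorem mapG_mem_G'' {D : S.G} (h : D ∈ S.G'') : S.mapG L D ∈ (S.baseChange L).G'' :=
  ⟨S.mapG_mem_G' L h.1, by
    have := AddMonoidHom.mem_ker.1 h.2
    exact AddMonoidHom.mem_ker.2 (by rw [degG_mapG, this])⟩

/-- The homomorphism `H_S(K) → H_S(L)`, `[P] ↦ [P]`. -/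
def mapH : S.H →+ (S.baseChange L).H :=
  QuotientAddGroup.map S.G'' (S.baseChange L).G'' (S.mapG L) fun _ h => S.mapG_mem_G'' L h

theorem deg_mapH (D : S.H) : (S.baseChange L).deg (S.mapH L D) = S.deg D := by
  induction D using QuotientAddGroup.induction_on with
  | H D => exact S.degG_mapG L D

/-- The homomorphism `H⁰_S(K) → H⁰_S(L)`. -/
def mapH0 : S.H0 →+ (S.baseChange L).H0 :=
  ((S.mapH L).comp S.H0.subtype).codRestrict _ fun D => by
    exact AddMonoidHom.mem_ker.2 ((S.deg_mapH L D.1).trans (AddMonoidHom.mem_ker.1 D.2))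

end BaseChange

section Topology

variable {L : Type*} [Field L] [TopologicalSpace L] (S : CubicForm L)

/-- The topology of `S(L)` induced by that of `L`: the subspace topology from `ℙ³(L)`, which
carries the quotient topology from `L⁴ ∖ {0}`. -/
instance : TopologicalSpace S.Points :=
  TopologicalSpace.induced Subtype.val
    (TopologicalSpace.coinduced (Projectivization.mk' L (V := Fin 4 → L)) inferInstance)

end Topology

end CubicForm

open NumberField IsDedekindDomain

/-- The places of a number field: the infinite ones and the finite ones (the latter given by
the nonzero primes of the ring of integers). -/
abbrev Place (K : Type*) [Field K] : Type _ := InfinitePlace K ⊕ HeightOneSpectrum (𝓞 K)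

namespace Place

variable {K : Type*} [Field K] [NumberField K]

/-- The completion `K_v`. -/
def Completion : Place K → Type _
  | .inl v => v.Completion
  | .inr v => v.adicCompletion K

instance : (v : Place K) → Field v.Completion
  | .inl v => inferInstanceAs (Field v.Completion)
  | .inr v => inferInstanceAs (Field (v.adicCompletion K))

instance : (v : Place K) → TopologicalSpace v.Completion
  | .inl v => inferInstanceAs (TopologicalSpace v.Completion)
  | .inr v => inferInstanceAs (TopologicalSpace (v.adicCompletion K))

instance : (v : Place K) → Algebra K v.Completion
  | .inl v => inferInstanceAs (Algebra K v.Completion)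
  | .inr v => inferInstanceAs (Algebra K (v.adicCompletion K))

/-- A vector over `K_v` is primitive if its coordinates are integral and at least one of them is
a unit (`v` finite). No condition is imposed at an infinite place. -/
def IsPrimitive : (v : Place K) → (Fin 4 → v.Completion) → Prop
  | .inl _, _ => True
  | .inr v, (x : Fin 4 → v.adicCompletion K) =>
      (∀ i, x i ∈ v.adicCompletionIntegers K) ∧ ∃ i, Valued.v (x i) = 1

theorem exists_isPrimitive_smul (v : Place K) (x : Fin 4 → v.Completion) (hx : x ≠ 0) :
    ∃ c : v.Completion, v.IsPrimitive (c • x) := by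
  rcases v with v | v
  · exact ⟨1, trivial⟩
  · change Fin 4 → v.adicCompletion K at x
    obtain ⟨i, hi⟩ := Finite.exists_max fun i => Valued.v (x i)
    have hxi : x i ≠ 0 := fun h0 => hx <| by
      funext j
      have := hi j
      rw [h0, map_zero, le_zero_iff, map_eq_zero] at this
      exact this
    have hv : Valued.v (x i) ≠ 0 := by simpa using hxi
    suffices h : (∀ j, (x i)⁻¹ * x j ∈ v.adicCompletionIntegers K) ∧
        ∃ j, Valued.v ((x i)⁻¹ * x j) = 1 from ⟨(x i)⁻¹, h⟩
    refine ⟨fun j => ?_, i, by simp [hxi]⟩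
    rw [HeightOneSpectrum.mem_adicCompletionIntegers, map_mul, map_inv₀]
    calc _ ≤ (Valued.v (x i))⁻¹ * Valued.v (x i) := by gcongr; exact hi j
      _ = 1 := inv_mul_cancel₀ hv

end Place

namespace CubicForm

variable {K : Type*} [Field K] [NumberField K] (S : CubicForm K)

/-- The subset `S(O_v)` of `S(K_v)` for a finite place `v`: the points with a primitive
coordinate vector. It is all of `S(K_v)` by definition at an infinite place. -/
def integralPoints (v : Place K) : Set (S.baseChange v.Completion).Points :=
  {P | ∃ x ∈ P.1.submodule, v.IsPrimitive x}

/-- The space `S(𝔸_K^T)` of points of `S` with values in the adeles of `K` with the components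
at the places in `T` removed: the restricted product of the `S(K_v)`, `v ∉ T`, with respect to
the `S(O_v)`, with its restricted product topology. -/
abbrev AdelicPoints (T : Set (Place K)) : Type _ :=
  Πʳ v : {v : Place K // v ∉ T},
    [(S.baseChange (v : Place K).Completion).Points, S.integralPoints v]

theorem mem_integralPoints (v : Place K) (P : (S.baseChange v.Completion).Points) :
    P ∈ S.integralPoints v := by
  obtain ⟨P, hP⟩ := P
  induction P using Projectivization.ind with
  | h x hx =>
    obtain ⟨c, hc⟩ := v.exists_isPrimitive_smul x hx
    exact ⟨c • x, Submodule.smul_mem _ _ (Submodule.mem_span_singleton_self x), hc⟩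

/-- The diagonal map `S(K) → S(𝔸_K^T)`. -/
def toAdelicPoints (T : Set (Place K)) (P : S.Points) : S.AdelicPoints T :=
  ⟨fun v => S.mapPoints (v : Place K).Completion P,
    .of_forall fun _ => S.mem_integralPoints _ _⟩

/-- The diagonal homomorphism `H⁰_S(K) → ∏_{v ∈ Δ} H⁰_S(K_v)`. -/
def diagonalH0 (Δ : Finset (Place K)) :
    S.H0 →+ ((v : Δ) → (S.baseChange (v : Place K).Completion).H0) :=
  AddMonoidHom.pi fun v => S.mapH0 (v : Place K).Completion

end CubicForm

end

open scoped Topology ContDiff Polynomial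

/-! The core is local: over a completion `K_v` the class of a point in `H_S(K_v)` is locally
constant for the `v`-adic topology (`CubicForm.eventually_pointClass_eq`). Granting this, density of
`S(K)` away from `T` realizes any tuple of local point classes on `Δ` by a single rational point
(`IsSmooth.exists_pointClass_eq`). For the tuple equal to P at one place v and to a rational base
point O at the others, this gives Q such that Q - O maps to [P] - [O] at v and to 0 elsewhere. Such
tuples generate the product.

For local constancy, write the cubic as F(x) = f(x,x,x) with f symmetric trilinear. All collinear
triples have the same class sum h. Let P be a non-Eckardt point: f(P,w,w) ≠ 0 for some tangent
direction w. A point A ≠ P of the tangent plane section at P has class h - 2[P], and a point R ≠ A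
of the tangent plane section at A has class h - 2[A], so [R] depends on P alone. By smoothness the
Gauss map contracts no curve, so the tangent plane at A moves with A. The implicit function theorem
then shows that the points R fill a neighbourhood of some point (`IsClassMap.exists_constNear`).

Chords through a fixed point carry local constancy from Q to any B whose tangent plane misses Q
(`IsClassMap.constNear_of_constNear`). A suitable Q always exists, since a neighbourhood of a
non-Eckardt point lies in no plane (`Nonsingular.exists_notMem_plane`). -/

/-- A symmetric trilinear form on `R ^ ι`, given by its coefficients. -/
structure SymmTrilin (ι R : Type*) where
  /-- the coefficients -/
  coeff : ι → ι → ι → R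
  swap_left : ∀ i j k, coeff i j k = coeff j i k
  swap_right : ∀ i j k, coeff i j k = coeff i k j

/-! ### Symmetric trilinear forms: multilinearity, polars, change of coefficients -/

namespace SymmTrilin

section Form

variable {ι R : Type*} [Fintype ι] [CommRing R] (T : SymmTrilin ι R)

/-- The value of the trilinear form. -/
def form (x y z : ι → R) : R := ∑ i, ∑ j, ∑ k, T.coeff i j k * (x i * (y j * z k))

theorem form_swap_left (x y z : ι → R) : T.form x y z = T.form y x z := by
  unfold form
  rw [Finset.sum_comm]
  refine Finset.sum_congr rfl fun i _ => Finset.sum_congr rfl fun j _ =>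
    Finset.sum_congr rfl fun k _ => ?_
  rw [T.swap_left]
  ring

theorem form_swap_right (x y z : ι → R) : T.form x y z = T.form x z y := by
  unfold form
  refine Finset.sum_congr rfl fun i _ => ?_
  rw [Finset.sum_comm]
  refine Finset.sum_congr rfl fun j _ => Finset.sum_congr rfl fun k _ => ?_
  rw [T.swap_right]
  ring

theorem form_add_right (x y z w : ι → R) : T.form x y (z + w) = T.form x y z + T.form x y w := by
  simp only [form, Pi.add_apply, mul_add, Finset.sum_add_distrib]

theorem form_smul_right (c : R) (x y z : ι → R) : T.form x y (c • z) = c * T.form x y z := by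
  simp only [form, Pi.smul_apply, smul_eq_mul, Finset.mul_sum]
  refine Finset.sum_congr rfl fun i _ => Finset.sum_congr rfl fun j _ =>
    Finset.sum_congr rfl fun k _ => ?_
  ring

theorem form_add_mid (x y z w : ι → R) : T.form x (z + w) y = T.form x z y + T.form x w y := by
  rw [form_swap_right, form_add_right, T.form_swap_right x y, T.form_swap_right x y]

theorem form_smul_mid (c : R) (x y z : ι → R) : T.form x (c • z) y = c * T.form x z y := by
  rw [form_swap_right, form_smul_right, T.form_swap_right x y]

theorem form_add_left (x y z w : ι → R) : T.form (z + w) x y = T.form z x y + T.form w x y := by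
  rw [form_swap_left, form_add_mid, T.form_swap_left x, T.form_swap_left x]

theorem form_smul_left (c : R) (x y z : ι → R) : T.form (c • z) x y = c * T.form z x y := by
  rw [form_swap_left, form_smul_mid, T.form_swap_left x]

theorem form_neg_right (x y z : ι → R) : T.form x y (-z) = -T.form x y z := by
  rw [← neg_one_smul R, form_smul_right, neg_one_mul]

theorem form_neg_mid (x y z : ι → R) : T.form x (-z) y = -T.form x z y := by
  rw [← neg_one_smul R, form_smul_mid, neg_one_mul]

theorem form_neg_left (x y z : ι → R) : T.form (-z) x y = -T.form z x y := by
  rw [← neg_one_smul R, form_smul_left, neg_one_mul]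

theorem form_sub_right (x y z w : ι → R) : T.form x y (z - w) = T.form x y z - T.form x y w := by
  rw [sub_eq_add_neg, form_add_right, form_neg_right, sub_eq_add_neg]

theorem form_sub_left (x y z w : ι → R) : T.form (z - w) x y = T.form z x y - T.form w x y := by
  rw [sub_eq_add_neg, form_add_left, form_neg_left, sub_eq_add_neg]

/-- The form as a linear map in its last argument. -/
def formₗ (x y : ι → R) : (ι → R) →ₗ[R] R where
  toFun := T.form x y
  map_add' := T.form_add_right x y
  map_smul' c := T.form_smul_right c x y

@[simp] theorem formₗ_apply (x y z : ι → R) : T.formₗ x y z = T.form x y z := rfl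

variable [DecidableEq ι]

theorem form_eq_sum_right (x y z : ι → R) :
    T.form x y z = ∑ i, z i * T.form x y (Pi.single i 1) := by
  conv_lhs => rw [pi_eq_sum_univ' z, ← formₗ_apply, map_sum]
  refine Finset.sum_congr rfl fun i _ => ?_
  rw [map_smul, formₗ_apply, smul_eq_mul]

/-- The polar vector `f(x, y, ·)`. -/
def polar (x y : ι → R) (i : ι) : R := T.form x y (Pi.single i 1)

theorem form_eq_sum_polar (x y z : ι → R) : T.form x y z = ∑ i, z i * T.polar x y i :=
  T.form_eq_sum_right x y z

/-- No nonzero vector is a zero of the gradient. -/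
def Nonsingular : Prop := ∀ x : ι → R, T.polar x x = 0 → x = 0

end Form

section Map

variable {ι R R' : Type*} [CommRing R] [CommRing R'] (T : SymmTrilin ι R)

/-- Change of coefficients. -/
def map (φ : R →+* R') : SymmTrilin ι R' where
  coeff i j k := φ (T.coeff i j k)
  swap_left i j k := by rw [T.swap_left]
  swap_right i j k := by rw [T.swap_right]

theorem map_map {R'' : Type*} [CommRing R''] (φ : R →+* R') (ψ : R' →+* R'') :
    (T.map φ).map ψ = T.map (ψ.comp φ) := rfl

theorem map_id : T.map (RingHom.id R) = T := rfl

variable [Fintype ι]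

theorem map_form (φ : R →+* R') (x y z : ι → R) :
    φ (T.form x y z) = (T.map φ).form (fun i => φ (x i)) (fun i => φ (y i)) fun i => φ (z i) := by
  simp only [form, map, map_sum, map_mul]

theorem map_polar [DecidableEq ι] (φ : R →+* R') (x y : ι → R) (i : ι) :
    φ (T.polar x y i) = (T.map φ).polar (fun i => φ (x i)) (fun i => φ (y i)) i := by
  rw [polar, polar, map_form]
  congr 1
  ext j
  by_cases h : j = i
  · subst h; simp
  · simp [h]

theorem eval_form (A B D : ι → R[X]) (s : R) :
    ((T.map Polynomial.C).form A B D).eval s =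
      T.form (fun i => (A i).eval s) (fun i => (B i).eval s) fun i => (D i).eval s := by
  have := (T.map Polynomial.C).map_form (Polynomial.evalRingHom s) A B D
  rw [map_map] at this
  have e : (Polynomial.evalRingHom s).comp Polynomial.C = RingHom.id R := by ext; simp
  rw [e] at this
  exact this

theorem eval_polar [DecidableEq ι] (A B : ι → R[X]) (s : R) (i : ι) :
    ((T.map Polynomial.C).polar A B i).eval s =
      T.polar (fun i => (A i).eval s) (fun i => (B i).eval s) i := by
  have := (T.map Polynomial.C).map_polar (Polynomial.evalRingHom s) A B i
  rw [map_map] at this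
  have e : (Polynomial.evalRingHom s).comp Polynomial.C = RingHom.id R := by ext; simp
  rw [e] at this
  exact this

theorem polar_eq_sum [DecidableEq ι] (x y : ι → R) (k : ι) :
    T.polar x y k = ∑ i, ∑ j, T.coeff i j k * (x i * y j) := by
  simp [polar, form, Pi.single_apply]

theorem coeff_polar [DecidableEq ι] {d : ℕ} {A : ι → R[X]} (h : ∀ i, (A i).natDegree ≤ d)
    (k : ι) : ((T.map Polynomial.C).polar A A k).coeff (d + d) =
      T.polar (fun i => (A i).coeff d) (fun i => (A i).coeff d) k := by
  rw [polar_eq_sum, polar_eq_sum, Polynomial.finsetSum_coeff]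
  refine Finset.sum_congr rfl fun i _ => ?_
  rw [Polynomial.finsetSum_coeff]
  refine Finset.sum_congr rfl fun j _ => ?_
  change (Polynomial.C _ * _).coeff _ = _
  rw [Polynomial.coeff_C_mul, Polynomial.coeff_mul_add_eq_of_natDegree_le (h i) (h j)]

end Map

/-! ### The Gauss map contracts no polynomial curve -/

section GaussMap

variable {ι E : Type*} [Fintype ι] [DecidableEq ι] [Field E]

theorem polar_smul_smul {R : Type*} [CommRing R] (T : SymmTrilin ι R) (c d : R) (x y : ι → R) :
    T.polar (c • x) (d • y) = (c * d) • T.polar x y := by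
  ext i
  simp only [polar, form_smul_left, form_smul_mid, Pi.smul_apply, smul_eq_mul]
  ring

/-- A polynomial curve whose image under the gradient has constant direction is, up to a scalar
factor, constant. -/
theorem Nonsingular.exists_eq_smul [IsAlgClosed E] {T : SymmTrilin ι E} (hT : T.Nonsingular)
    {φ : ι → E} (hφ : φ ≠ 0) (d : ℕ) (A : ι → E[X]) (hd : ∀ i, (A i).natDegree ≤ d)
    (hA : ∀ i j, Polynomial.C (φ i) * (T.map Polynomial.C).polar A A j =
      Polynomial.C (φ j) * (T.map Polynomial.C).polar A A i) :
    ∃ (g : E[X]) (a : ι → E), ∀ i, A i = g * Polynomial.C (a i) := by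
  induction d generalizing A with
  | zero =>
    refine ⟨1, fun i => (A i).coeff 0, fun i => ?_⟩
    rw [one_mul]
    exact Polynomial.eq_C_of_natDegree_le_zero (hd i)
  | succ d ih =>
    obtain ⟨i, hi⟩ := Function.ne_iff.1 hφ
    simp only [Pi.zero_apply] at hi
    by_cases hlead : ∀ i, (A i).coeff (d + 1) = 0
    · refine ih A (fun j => ?_) hA
      rw [Polynomial.natDegree_le_iff_coeff_eq_zero]
      intro N hN
      rcases Nat.lt_or_ge (d + 1) N with h | h
      · exact Polynomial.coeff_eq_zero_of_natDegree_lt ((hd j).trans_lt h)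
      · obtain rfl : N = d + 1 := le_antisymm h hN
        exact hlead j
    -- The vector of top coefficients is nonzero here. If the `i`-th coordinate of the gradient had
    -- degree zero, the gradient of that vector would vanish, against nonsingularity. At a root of
    -- this coordinate the whole gradient vanishes, so `A` itself vanishes there and a linear factor
    -- splits off.
    · have hroot : ∃ s, ((T.map Polynomial.C).polar A A i).IsRoot s := by
        refine IsAlgClosed.exists_root _ fun h0 => hlead ?_
        have hz : ((T.map Polynomial.C).polar A A i).coeff (d + 1 + (d + 1)) = 0 :=
          Polynomial.coeff_eq_zero_of_degree_lt (by rw [h0]; exact_mod_cast Nat.succ_pos _)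
        have : T.polar (fun i => (A i).coeff (d + 1)) (fun i => (A i).coeff (d + 1)) = 0 := by
          ext j
          have := congrArg (fun p => p.coeff (d + 1 + (d + 1))) (hA i j)
          simp only [Polynomial.coeff_C_mul, hz, mul_zero, coeff_polar T hd] at this
          exact (mul_eq_zero.1 this).resolve_left hi
        exact congrFun (hT _ this)
      obtain ⟨s, hs⟩ := hroot
      have hz : (fun i => (A i).eval s) = 0 := by
        refine hT _ ?_
        ext j
        have := congrArg (fun p => p.eval s) (hA i j)
        simp only [Polynomial.eval_mul, Polynomial.eval_C, hs.eq_zero, mul_zero] at this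
        rw [← eval_polar]
        exact (mul_eq_zero.1 this).resolve_left hi
      have hdvd : ∀ j, ∃ B, A j = (Polynomial.X - Polynomial.C s) * B :=
        fun j => Polynomial.dvd_iff_isRoot.2 (congrFun hz j)
      choose B hB using hdvd
      have hX : (Polynomial.X - Polynomial.C s : E[X]) ≠ 0 := Polynomial.X_sub_C_ne_zero s
      have hAB : A = (Polynomial.X - Polynomial.C s) • B := by ext1 j; simp [hB j]
      obtain ⟨g, a, hga⟩ := ih B (fun j => by
        by_cases h0 : B j = 0
        · simp [h0]
        · have := hd j
          rw [hB j, Polynomial.natDegree_mul hX h0, Polynomial.natDegree_X_sub_C] at this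
          omega) fun j k => by
        have := hA j k
        rw [hAB, polar_smul_smul] at this
        refine mul_left_cancel₀ (mul_ne_zero hX hX) ?_
        simp only [Pi.smul_apply, smul_eq_mul] at this
        linear_combination this
      exact ⟨(Polynomial.X - Polynomial.C s) * g, a, fun j => by rw [hB j, hga j, mul_assoc]⟩

/-- Two points of a polynomial curve over `L` whose gradient has constant direction are
proportional. -/
theorem Nonsingular.eval_mul_eval_comm {L : Type*} [Field L] [Infinite L] [Algebra L E]
    [IsAlgClosed E] {T : SymmTrilin ι L} (hT : (T.map (algebraMap L E)).Nonsingular)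
    {φ : ι → L} (hφ : φ ≠ 0) (A : ι → L[X])
    (hA : ∀ s i j, φ i * T.polar (fun k => (A k).eval s) (fun k => (A k).eval s) j =
      φ j * T.polar (fun k => (A k).eval s) (fun k => (A k).eval s) i) (s t : L) (i j : ι) :
    (A i).eval s * (A j).eval t = (A j).eval s * (A i).eval t := by
  have hpoly : ∀ i j, Polynomial.C (φ i) * (T.map Polynomial.C).polar A A j =
      Polynomial.C (φ j) * (T.map Polynomial.C).polar A A i :=
    fun i j => Polynomial.funext fun s => by simpa [eval_polar] using hA s i j
  have hφ' : (fun i => algebraMap L E (φ i)) ≠ 0 := fun h => hφ <| funext fun i => by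
    simpa using congrFun h i
  obtain ⟨g, a, hga⟩ := hT.exists_eq_smul hφ' (Finset.univ.sup fun i => (A i).natDegree)
    (fun i => (A i).map (algebraMap L E)) (fun i => Polynomial.natDegree_map_le.trans
      (Finset.le_sup (f := fun i => (A i).natDegree) (Finset.mem_univ i))) fun i j => by
      have := congrArg (Polynomial.map (algebraMap L E)) (hpoly i j)
      have e : (Polynomial.mapRingHom (algebraMap L E)).comp Polynomial.C =
          Polynomial.C.comp (algebraMap L E) := by ext; simp
      have key : ∀ k, Polynomial.map (algebraMap L E) ((T.map Polynomial.C).polar A A k) =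
          ((T.map (algebraMap L E)).map Polynomial.C).polar (fun i => (A i).map (algebraMap L E))
            (fun i => (A i).map (algebraMap L E)) k := fun k => by
        have := (T.map Polynomial.C).map_polar (Polynomial.mapRingHom (algebraMap L E)) A A k
        rw [map_map, e] at this
        exact this
      simpa [key] using this
  have hev : ∀ i s, algebraMap L E ((A i).eval s) = g.eval (algebraMap L E s) * a i := fun i s => by
    have := congrArg (fun p => p.eval (algebraMap L E s)) (hga i)
    simpa only [Polynomial.eval_mul, Polynomial.eval_C, Polynomial.eval_map_algebraMap,
      Polynomial.aeval_algebraMap_apply_eq_algebraMap_eval] using this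
  apply (algebraMap L E).injective
  simp only [map_mul, hev]
  ring

end GaussMap

end SymmTrilin

/-! ### Two tools: Wronskians and a scalar implicit function theorem -/

namespace Polynomial

/-- In characteristic zero, polynomials with vanishing Wronskian are proportional. -/
theorem exists_eq_C_mul_of_wronskian_eq_zero {L : Type*} [Field L] [CharZero L]
    {p q : L[X]} (hp : p ≠ 0) (h : p * derivative q = q * derivative p) :
    ∃ c, q = C c * p := by
  -- Top coefficients of the two products carry the factors deg r and deg p, so in characteristic
  -- zero the degrees agree.
  have key : ∀ r : L[X], r ≠ 0 → p * derivative r = r * derivative p →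
      r.natDegree = p.natDegree := by
    intro r hr hw
    have hlc : p.leadingCoeff * r.leadingCoeff ≠ 0 := by simp [hp, hr]
    rcases Nat.eq_zero_or_pos r.natDegree with h0 | h0
    · have hd : derivative r = 0 := by
        rw [eq_C_of_natDegree_eq_zero h0, derivative_C]
      rw [hd, mul_zero, eq_comm, mul_eq_zero, or_iff_right hr] at hw
      rw [h0, derivative_eq_zero.1 hw]
    · rcases Nat.eq_zero_or_pos p.natDegree with h1 | h1
      · have hd : derivative p = 0 := by
          rw [eq_C_of_natDegree_eq_zero h1, derivative_C]
        rw [hd, mul_zero, mul_eq_zero, or_iff_right hp] at hw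
        rw [h1, derivative_eq_zero.1 hw]
      · obtain ⟨n, hn⟩ := Nat.exists_eq_succ_of_ne_zero h0.ne'
        obtain ⟨m, hm⟩ := Nat.exists_eq_succ_of_ne_zero h1.ne'
        have := congrArg (fun p => p.coeff (m + 1 + n)) hw
        rw [coeff_mul_add_eq_of_natDegree_le hm.le (by
            have := natDegree_derivative_le r; omega), show m + 1 + n = n + 1 + m by ring,
          coeff_mul_add_eq_of_natDegree_le hn.le (by
            have := natDegree_derivative_le p; omega), coeff_derivative, coeff_derivative] at this
        rw [leadingCoeff, leadingCoeff, hn, hm] at hlc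
        have h2 : (p.coeff (m + 1) * r.coeff (n + 1)) * (n + 1 : L) =
            (p.coeff (m + 1) * r.coeff (n + 1)) * (m + 1 : L) := by
          linear_combination this
        have h3 := mul_left_cancel₀ hlc h2
        have h4 : n = m := by exact_mod_cast add_right_cancel h3
        rw [hn, hm, h4]
  -- This constant kills the coefficient of q - c p in degree deg p. The difference still has
  -- vanishing Wronskian with p, so by `key` it must be zero.
  refine ⟨q.coeff p.natDegree / p.leadingCoeff, ?_⟩
  by_contra hne
  set c := q.coeff p.natDegree / p.leadingCoeff
  have hr : q - C c * p ≠ 0 := sub_ne_zero.2 hne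
  have hdeg := key _ hr (by simp only [derivative_sub, derivative_C_mul]; linear_combination h)
  apply hr
  rw [← leadingCoeff_eq_zero, leadingCoeff, hdeg, coeff_sub, coeff_C_mul]
  have : p.leadingCoeff ≠ 0 := by simpa using hp
  simp only [c, coeff_natDegree]
  field_simp
  ring

end Polynomial

/-- The implicit function theorem for a scalar equation: a simple root persists under
perturbation of the parameters. -/
theorem eventually_exists_root {L : Type*} [NontriviallyNormedField L] [CompleteSpace L]
    {E : Type*} [NormedAddCommGroup E] [NormedSpace L E] [CompleteSpace E] {Φ : E × L → L} {x : E}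
    {a : L} (hΦ : ContDiff L ω Φ) (h0 : Φ (x, a) = 0) {d : L}
    (hd : HasDerivAt (fun t => Φ (x, t)) d a) (hd0 : d ≠ 0) {N : Set L} (hN : N ∈ 𝓝 a) :
    ∀ᶠ y in 𝓝 x, ∃ t ∈ N, Φ (y, t) = 0 := by
  have h1 := (hΦ.contDiffAt (x := (x, a))).analyticAt.hasStrictFDerivAt
  set Φ' := fderiv L Φ (x, a)
  have hΦ' : Φ' (0, 1) = d := by
    have h2 : HasFDerivAt (fun t : L => (x, t)) (ContinuousLinearMap.inr L E L) a :=
      hasFDerivAt_prodMk_right x a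
    have h3 := (h1.hasFDerivAt.comp a h2).hasDerivAt
    have := h3.unique hd
    simpa using this
  -- The map (y, t) ↦ (y, Φ(y, t)) has surjective derivative, hence is open at the base point, and a
  -- preimage of (y, 0) is a root over y.
  have h4 : HasStrictFDerivAt (fun p : E × L => (p.1, Φ p))
      ((ContinuousLinearMap.fst L E L).prod Φ') (x, a) :=
    hasStrictFDerivAt_fst.prodMk h1
  have hsurj : ((ContinuousLinearMap.fst L E L).prod Φ').range = ⊤ := by
    rw [LinearMap.range_eq_top]
    rintro ⟨y, b⟩
    refine ⟨(y, (b - Φ' (y, 0)) / d), ?_⟩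
    have : (y, (b - Φ' (y, 0)) / d) = (y, 0) + ((b - Φ' (y, 0)) / d) • ((0 : E), (1 : L)) := by
      simp
    have h : Φ' (y, (b - Φ' (y, 0)) / d) = b := by
      rw [this, map_add, map_smul, hΦ', smul_eq_mul, div_mul_cancel₀ _ hd0]
      ring
    simp [h]
  have h5 := h4.map_nhds_eq_of_surj hsurj
  have h6 : (fun p : E × L => (p.1, Φ p)) '' (Set.univ ×ˢ N) ∈ 𝓝 (x, (0 : L)) := by
    rw [← h0, ← h5]
    exact Filter.image_mem_map (prod_mem_nhds Filter.univ_mem hN)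
  have h7 : ContinuousAt (fun y : E => (y, (0 : L))) x := by fun_prop
  filter_upwards [h7 h6] with y hy
  obtain ⟨⟨y', t⟩, ⟨-, ht⟩, hyt⟩ := hy
  simp only [Prod.mk.injEq] at hyt
  obtain ⟨rfl, hyt⟩ := hyt
  exact ⟨t, ht, hyt⟩

/-! ### Chord and tangent constructions, and derivatives along polynomial curves -/

namespace SymmTrilin

section Expand

variable {ι R : Type*} [Fintype ι] [CommRing R] (T : SymmTrilin ι R)

theorem form_comb (a b : R) (x y z : ι → R) :
    T.form (a • x + b • y) (a • x + b • y) z =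
      a ^ 2 * T.form x x z + 2 * a * b * T.form x y z + b ^ 2 * T.form y y z := by
  simp only [form_add_left, form_add_mid, form_smul_left, form_smul_mid, T.form_swap_left y x]
  ring

theorem form_comb_self (a b : R) (x y : ι → R) :
    T.form (a • x + b • y) (a • x + b • y) (a • x + b • y) =
      a ^ 3 * T.form x x x + 3 * a ^ 2 * b * T.form x x y + 3 * a * b ^ 2 * T.form x y y +
        b ^ 3 * T.form y y y := by
  rw [form_comb]
  simp only [form_add_right, form_smul_right, T.form_swap_right x y x,
    T.form_swap_right y y x, T.form_swap_left y x y]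
  ring

/-- The third point of intersection of the cubic `f(x, x, x) = 0` with the line through two of
its points. -/
def third (x y : ι → R) : ι → R := T.form x y y • x - T.form x x y • y

theorem form_third (x y z : ι → R) : T.form (T.third x y) (T.third x y) z =
    T.form x y y ^ 2 * T.form x x z - 2 * T.form x y y * T.form x x y * T.form x y z +
      T.form x x y ^ 2 * T.form y y z := by
  rw [third, sub_eq_add_neg, ← neg_smul, form_comb]
  ring

theorem form_third_self {x y : ι → R} (hx : T.form x x x = 0) (hy : T.form y y y = 0) :
    T.form (T.third x y) (T.third x y) (T.third x y) = 0 := by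
  rw [third, sub_eq_add_neg, ← neg_smul, form_comb_self, hx, hy]
  ring

/-- The point residual to the double point `p` on its tangent in direction `u`. -/
def residual (p u : ι → R) : ι → R := T.form u u u • p - (3 * T.form p u u) • u

theorem form_residual_self {p u : ι → R} (hp : T.form p p p = 0) (hu : T.form p p u = 0) :
    T.form (T.residual p u) (T.residual p u) (T.residual p u) = 0 := by
  rw [residual, sub_eq_add_neg, ← neg_smul, form_comb_self, hp, hu]
  ring

theorem form_residual {p u : ι → R} (hp : T.form p p p = 0) (hu : T.form p p u = 0) :
    T.form p p (T.residual p u) = 0 := by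
  rw [residual, form_sub_right, form_smul_right, form_smul_right, hp, hu]
  ring

theorem derivative_form (T : SymmTrilin ι R) (A B D : ι → R[X]) :
    Polynomial.derivative ((T.map Polynomial.C).form A B D) =
      (T.map Polynomial.C).form (fun i => Polynomial.derivative (A i)) B D +
      (T.map Polynomial.C).form A (fun i => Polynomial.derivative (B i)) D +
      (T.map Polynomial.C).form A B (fun i => Polynomial.derivative (D i)) := by
  simp only [form, map, Polynomial.derivative_sum, ← Finset.sum_add_distrib]
  refine Finset.sum_congr rfl fun i _ => Finset.sum_congr rfl fun j _ =>
    Finset.sum_congr rfl fun k _ => ?_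
  simp only [Polynomial.derivative_mul, Polynomial.derivative_C]
  ring

theorem derivative_form_self (T : SymmTrilin ι R) (A : ι → R[X]) :
    Polynomial.derivative ((T.map Polynomial.C).form A A A) =
      3 * (T.map Polynomial.C).form A A (fun i => Polynomial.derivative (A i)) := by
  rw [derivative_form, form_swap_left, form_swap_right]
  ring

theorem derivative_form_const (T : SymmTrilin ι R) (A : ι → R[X]) (z : ι → R) :
    Polynomial.derivative ((T.map Polynomial.C).form A A fun i => Polynomial.C (z i)) =
      2 * (T.map Polynomial.C).form A (fun i => Polynomial.derivative (A i))
        fun i => Polynomial.C (z i) := by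
  have h0 : (fun i => Polynomial.derivative (Polynomial.C (z i))) = (0 : R[X]) • (0 : ι → R[X]) := by
    ext1 i; simp
  rw [derivative_form, h0, form_smul_right, form_swap_left]
  ring

theorem derivative_polar [DecidableEq ι] (T : SymmTrilin ι R) (A : ι → R[X]) (i : ι) :
    Polynomial.derivative ((T.map Polynomial.C).polar A A i) =
      2 * (T.map Polynomial.C).polar A (fun i => Polynomial.derivative (A i)) i := by
  have h : (Pi.single i 1 : ι → R[X]) = fun j => Polynomial.C ((Pi.single i 1 : ι → R) j) := by
    ext1 j
    by_cases h : j = i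
    · subst h; simp
    · simp [h]
  rw [polar, polar, h, derivative_form_const]

end Expand

section Topological

variable {ι R X : Type*} [Fintype ι] [CommRing R] [TopologicalSpace R] [IsTopologicalRing R]
  [TopologicalSpace X] (T : SymmTrilin ι R)

@[fun_prop]
theorem continuous_form {f g h : X → ι → R} (hf : Continuous f) (hg : Continuous g)
    (hh : Continuous h) : Continuous fun x => T.form (f x) (g x) (h x) := by
  unfold form
  fun_prop

end Topological

section Field

variable {ι L : Type*} [Fintype ι] [DecidableEq ι] [Field L] {T : SymmTrilin ι L}

theorem Nonsingular.of_map {E : Type*} [Field E] [Algebra L E]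
    (hT : (T.map (algebraMap L E)).Nonsingular) : T.Nonsingular := by
  intro x hx
  have := hT (fun i => algebraMap L E (x i)) <| by
    ext i
    rw [← map_polar, hx]
    simp
  ext i
  simpa using congrFun this i

theorem Nonsingular.exists_form_ne_zero (hT : T.Nonsingular) {x : ι → L} (hx : x ≠ 0) :
    ∃ e, T.form x x e ≠ 0 := by
  by_contra! h
  exact hx (hT x (funext fun i => h _))

/-- A linear form vanishing on the kernel of another is proportional to it. Cross-multiplication
keeps the statement free of division. -/
theorem polar_mul_comm {p x y : ι → L} {q : ι → L}
    (h : ∀ z, T.form p q z = 0 → T.form x y z = 0) (i j : ι) :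
    T.polar p q i * T.polar x y j = T.polar p q j * T.polar x y i := by
  have := h (T.polar p q i • Pi.single j 1 - T.polar p q j • Pi.single i 1) <| by
    rw [form_sub_right, form_smul_right, form_smul_right]
    simp only [polar]
    ring
  rw [form_sub_right, form_smul_right, form_smul_right] at this
  simp only [polar] at this ⊢
  linear_combination this

end Field

end SymmTrilin

theorem not_linearIndependent_of_mul_comm {ι L : Type*} [Field L] {x y : ι → L}
    (h : ∀ i j, x i * y j = x j * y i) : ¬LinearIndependent L ![x, y] := by
  intro hli
  have hx : x ≠ 0 := by simpa using hli.ne_zero 0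
  obtain ⟨i, hi⟩ := Function.ne_iff.1 hx
  rw [LinearIndependent.pair_iff] at hli
  refine hi (neg_eq_zero.1 (hli (y i) (-x i) ?_).2)
  ext j
  simp only [Pi.add_apply, Pi.smul_apply, smul_eq_mul, Pi.zero_apply]
  linear_combination -(h i j)

/-- The kernel has dimension at least three. With φ = f(P,P,·) this supplies tangent directions
independent of prescribed ones. -/
theorem LinearMap.exists_mem_ker_notMem {L : Type*} [Field L] (φ : (Fin 4 → L) →ₗ[L] L)
    (W : Submodule L (Fin 4 → L)) (hW : Module.finrank L W ≤ 2) : ∃ u, φ u = 0 ∧ u ∉ W := by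
  by_contra! h
  have h1 : φ.ker ≤ W := fun u hu => h u hu
  have h2 := Submodule.finrank_mono h1
  have h3 := φ.finrank_range_add_finrank_ker
  have h4 : Module.finrank L φ.range ≤ 1 := by
    simpa using Submodule.finrank_le φ.range
  simp only [Module.finrank_fintype_fun_eq_card, Fintype.card_fin] at h3
  omega

namespace SymmTrilin

/-! ### Points of the surface near a given point -/

section Local

variable {L : Type*} [NontriviallyNormedField L]

section Approach

variable {ι : Type*} [Fintype ι] (T : SymmTrilin ι L)

/-- On a cubic hypersurface over a complete field, there are points near a smooth point `P` in
every tangent direction. -/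
theorem exists_near [CompleteSpace L] [CharZero L] {P w e : ι → L} (hP : T.form P P P = 0)
    (hw : T.form P P w = 0) (he : T.form P P e ≠ 0) {p : L × L → Prop}
    (hp : ∀ᶠ z in 𝓝 (0, -T.form P w w / T.form P P e), p z) :
    ∃ s τ, s ≠ 0 ∧ p (s, τ) ∧
      T.form (P + s • w + (s ^ 2 * τ) • e) (P + s • w + (s ^ 2 * τ) • e)
        (P + s • w + (s ^ 2 * τ) • e) = 0 := by
  let Φ : L × L → L := fun z => 3 * z.2 * T.form P P e + 3 * T.form P w w +
    6 * z.1 * z.2 * T.form P w e + 3 * z.1 ^ 2 * z.2 ^ 2 * T.form P e e + z.1 * T.form w w w +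
    3 * z.1 ^ 2 * z.2 * T.form w w e + 3 * z.1 ^ 3 * z.2 ^ 2 * T.form w e e +
    z.1 ^ 4 * z.2 ^ 3 * T.form e e e
  have hΦ : ContDiff L ω Φ := by fun_prop
  have hexp : ∀ s τ, T.form (P + s • w + (s ^ 2 * τ) • e) (P + s • w + (s ^ 2 * τ) • e)
      (P + s • w + (s ^ 2 * τ) • e) = s ^ 2 * Φ (s, τ) := by
    intro s τ
    have h1 := T.form_comb_self 1 (s ^ 2 * τ) (P + s • w) e
    have h2 := T.form_comb_self 1 s P w
    have h3 := T.form_comb 1 s P w e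
    simp only [one_smul] at h1 h2 h3
    rw [h1, h2, h3, form_add_left, form_smul_left, hP, hw]
    simp only [Φ]
    ring
  rw [nhds_prod_eq, Filter.eventually_prod_iff] at hp
  obtain ⟨pa, ha, pb, hb, hab⟩ := hp
  have hroot := eventually_exists_root (x := (0 : L)) (a := -T.form P w w / T.form P P e)
    (d := 3 * T.form P P e) hΦ (by simp only [Φ]; field_simp; ring)
    (by
      have : HasDerivAt (fun t : L => 3 * t * T.form P P e + 3 * T.form P w w)
          (3 * 1 * T.form P P e) (-T.form P w w / T.form P P e) :=
        ((((hasDerivAt_id _).const_mul 3).mul_const _).add_const _)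
      simpa [Φ] using this)
    (mul_ne_zero three_ne_zero he) hb
  have h0 : ∀ᶠ s in 𝓝[≠] (0 : L), s ≠ 0 := eventually_mem_nhdsWithin
  obtain ⟨s, hs0, hsa, τ, hτ, h⟩ :=
    (h0.and ((ha.and hroot).filter_mono nhdsWithin_le_nhds)).exists
  exact ⟨s, τ, hs0, hab hsa hτ, by rw [hexp, h, mul_zero]⟩

end Approach

variable [CharZero L] {T : SymmTrilin (Fin 4) L} {E : Type*} [Field E] [Algebra L E]

/-- A smooth cubic surface does not contain its tangent plane at `P`. -/
theorem Nonsingular.exists_form_ne_zero_of_tangent [IsAlgClosed E]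
    (hT : (T.map (algebraMap L E)).Nonsingular)
    {P : Fin 4 → L} (hP0 : P ≠ 0) (hP : T.form P P P = 0) :
    ∃ w, T.form P P w = 0 ∧ T.form w w w ≠ 0 := by
  by_contra! h
  -- Polarization: if F vanishes on the tangent plane, then f(x,x,·) vanishes on it for each x in
  -- it. The gradient then has constant direction along a line in this plane, which the Gauss map
  -- does not allow.
  have h2 : ∀ x y, T.form P P x = 0 → T.form P P y = 0 → T.form x x y = 0 := by
    intro x y hx hy
    have h1 := T.form_comb_self 1 1 x y
    have h2 := T.form_comb_self 1 (-1) x y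
    rw [h (_ + _) (by simp only [form_add_right, form_smul_right, hx, hy]; ring), h _ hx,
      h _ hy] at h1 h2
    have : 6 * T.form x x y = 0 := by linear_combination h2 - h1
    simpa using this
  obtain ⟨u, hu, huP⟩ := (T.formₗ P P).exists_mem_ker_notMem (Submodule.span L {P})
    ((finrank_span_le_card _).trans (by simp))
  simp only [formₗ_apply] at hu
  have hli : LinearIndependent L ![P, P + u] := by
    rw [LinearIndependent.pair_iff' hP0]
    intro a ha
    refine huP (Submodule.mem_span_singleton.2 ⟨a - 1, ?_⟩)
    rw [sub_smul, ha, one_smul, add_sub_cancel_left]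
  have hgrad : T.polar P P ≠ 0 := fun h0 => hP0 (Nonsingular.of_map hT P h0)
  refine not_linearIndependent_of_mul_comm (fun i j => ?_) hli
  have := Nonsingular.eval_mul_eval_comm hT hgrad
    (fun i => Polynomial.C (P i) + Polynomial.X * Polynomial.C (u i)) (fun s i j => ?_) 0 1 i j
  · simpa using this
  · simp only [Polynomial.eval_add, Polynomial.eval_C, Polynomial.eval_mul, Polynomial.eval_X]
    refine polar_mul_comm (fun z hz => h2 _ _ ?_ hz) i j
    change T.form P P (P + s • u) = 0
    rw [form_add_right, form_smul_right, hP, hu, mul_zero, add_zero]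

/-- Near every point of a smooth cubic surface there is a point which is not an Eckardt point. -/
theorem Nonsingular.exists_not_eckardt [CompleteSpace L] [IsAlgClosed E]
    (hT : (T.map (algebraMap L E)).Nonsingular)
    {P : Fin 4 → L} (hP0 : P ≠ 0) (hP : T.form P P P = 0) {U : Set (Fin 4 → L)} (hU : U ∈ 𝓝 P) :
    ∃ Q ∈ U, T.form Q Q Q = 0 ∧ ∃ w, T.form Q Q w = 0 ∧ T.form Q w w ≠ 0 := by
  by_contra! h
  obtain ⟨w, hw, hFw⟩ := hT.exists_form_ne_zero_of_tangent hP0 hP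
  obtain ⟨e, he⟩ := (Nonsingular.of_map hT).exists_form_ne_zero hP0
  have hPw : T.form P w w = 0 := h P (mem_of_mem_nhds hU) hP w hw
  let pt : L × L → Fin 4 → L := fun z => P + z.1 • w + (z.1 ^ 2 * z.2) • e
  let n : L × L → L := fun z => 2 * z.2 * T.form P w e + T.form w w w +
    2 * z.1 * z.2 * T.form w w e + z.1 ^ 2 * z.2 ^ 2 * T.form w e e
  -- At Q = `pt (s, τ)` the vector w' = f(Q,Q,e) w - f(Q,Q,w) e is tangent. Since f(Q,Q,w) = s² n
  -- and f(Q,w,w) is divisible by s, one gets f(Q,w',w') = s G, and G equals f(P,P,e)² F(w) ≠ 0 at s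
  -- = 0.
  let G : L × L → L := fun z =>
    T.form (pt z) (pt z) e ^ 2 * (T.form w w w + z.1 * z.2 * T.form w w e)
    - 2 * T.form (pt z) (pt z) e * z.1 * n z * T.form (pt z) w e
    + z.1 ^ 3 * n z ^ 2 * T.form (pt z) e e
  have hpt : Continuous pt := by fun_prop
  have hG : Continuous G := by fun_prop
  have hpt0 : ∀ b, pt (0, b) = P := fun b => by simp [pt]
  obtain ⟨s, τ, hs, ⟨hsU, hsG⟩, hs0⟩ := T.exists_near hP hw he
    (p := fun z => pt z ∈ U ∧ G z ≠ 0) <| by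
    refine Filter.Eventually.and (hpt.continuousAt (by rwa [hpt0])) (hG.continuousAt.eventually_ne ?_)
    simp only [G, hpt0]
    simp [he, hFw]
  change T.form (pt (s, τ)) (pt (s, τ)) (pt (s, τ)) = 0 at hs0
  have hD : T.form (pt (s, τ)) (pt (s, τ)) w = s ^ 2 * n (s, τ) := by
    have h1 := T.form_comb 1 (s ^ 2 * τ) (P + s • w) e w
    have h2 := T.form_comb 1 s P w w
    simp only [one_smul] at h1 h2
    simp only [pt, n]
    rw [h1, h2, form_add_left, form_smul_left, hPw, hw, T.form_swap_right P e w,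
      T.form_swap_right w e w, T.form_swap_right e e w, T.form_swap_left e w e]
    ring
  have hE : T.form (pt (s, τ)) w w = s * (T.form w w w + s * τ * T.form w w e) := by
    simp only [pt]
    rw [form_add_left, form_add_left, form_smul_left, form_smul_left, hPw, T.form_swap_left e w w,
      T.form_swap_right w e w]
    ring
  simp only [G] at hsG
  generalize pt (s, τ) = Q at *
  have h1 := h Q hsU hs0 (T.form Q Q e • w + (-T.form Q Q w) • e) <| by
    rw [form_add_right, form_smul_right, form_smul_right]
    ring
  rw [form_swap_left, form_swap_right, form_comb, T.form_swap_right w w Q,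
    T.form_swap_left w Q w, T.form_swap_right w e Q, T.form_swap_left w Q e,
    T.form_swap_right e e Q, T.form_swap_left e Q e, hE, hD] at h1
  refine hsG ((mul_eq_zero.1 ?_).resolve_left hs)
  linear_combination h1

/-- A neighbourhood of a point which is not an Eckardt point is not contained in a plane. -/
theorem Nonsingular.exists_notMem_plane [CompleteSpace L]
    (hT : (T.map (algebraMap L E)).Nonsingular)
    {P : Fin 4 → L} (hP0 : P ≠ 0) (hP : T.form P P P = 0) {w : Fin 4 → L} (hw : T.form P P w = 0)
    (hPw : T.form P w w ≠ 0) {U : Set (Fin 4 → L)} (hU : U ∈ 𝓝 P) (φ : (Fin 4 → L) →ₗ[L] L)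
    (hφ : φ ≠ 0) : ∃ Q ∈ U, T.form Q Q Q = 0 ∧ φ Q ≠ 0 := by
  obtain ⟨e, he⟩ := (Nonsingular.of_map hT).exists_form_ne_zero hP0
  by_cases hφP : φ P = 0
  swap
  · exact ⟨P, mem_of_mem_nhds hU, hP, hφP⟩
  -- Along P + s v + s² τ e the value of φ is s (φ v + s τ φ e).
  have key : ∀ v, T.form P P v = 0 → (∀ᶠ z in 𝓝 ((0 : L), -T.form P v v / T.form P P e),
      z.1 ≠ 0 → φ v + z.1 * z.2 * φ e ≠ 0) → ∃ Q ∈ U, T.form Q Q Q = 0 ∧ φ Q ≠ 0 := by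
    intro v hv hz
    have hpt : Continuous fun z : L × L => P + z.1 • v + (z.1 ^ 2 * z.2) • e := by fun_prop
    obtain ⟨s, τ, hs, ⟨hsU, hsφ⟩, h0⟩ := T.exists_near hP hv he
      (p := fun z => P + z.1 • v + (z.1 ^ 2 * z.2) • e ∈ U ∧
        (z.1 ≠ 0 → φ v + z.1 * z.2 * φ e ≠ 0)) <| by
      refine Filter.Eventually.and (hpt.continuousAt (by simpa using hU)) hz
    refine ⟨_, hsU, h0, ?_⟩
    simp only [map_add, map_smul, smul_eq_mul, hφP]
    have := mul_ne_zero hs (hsφ hs)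
    convert! this using 1
    ring
  by_cases hv : ∃ v, T.form P P v = 0 ∧ φ v ≠ 0
  · obtain ⟨v, hv, hφv⟩ := hv
    refine key v hv ?_
    have hc : Continuous fun z : L × L => φ v + z.1 * z.2 * φ e := by fun_prop
    filter_upwards [hc.continuousAt.eventually_ne (x := (0, _)) (y := (0 : L)) (by simpa using hφv)]
      with z hz _
    exact hz
  -- Now φ kills the tangent plane at P, so φ e ≠ 0. In the direction w the value is s² τ φ e, and τ
  -- stays near -f(P,w,w)/f(P,P,e), nonzero because P is not an Eckardt point.
  · push Not at hv
    have hφe : φ e ≠ 0 := by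
      intro h0
      refine hφ (LinearMap.ext fun x => ?_)
      have := hv (T.form P P e • x - T.form P P x • e) <| by
        rw [form_sub_right, form_smul_right, form_smul_right]
        ring
      simpa [h0, he] using this
    refine key w hw ?_
    have hc : Continuous fun z : L × L => z.2 := by fun_prop
    filter_upwards [hc.continuousAt.eventually_ne (x := ((0 : L), -T.form P w w / T.form P P e))
      (y := (0 : L)) (div_ne_zero (neg_ne_zero.2 hPw) he)]
      with z hz hz1
    rw [hv w hw, zero_add]
    exact mul_ne_zero (mul_ne_zero hz1 hz) hφe

end Local

end SymmTrilin

/-! ### Abstract class maps and transport of local constancy along chords -/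

namespace SymmTrilin

/-- A function on vectors which behaves like the class of a point of a cubic surface modulo the
relation that collinear triples of points have the same class. -/
structure IsClassMap {L H : Type*} [Field L] [AddCommGroup H] (T : SymmTrilin (Fin 4) L)
    (cl : (Fin 4 → L) → H) (h : H) : Prop where
  smul : ∀ c : L, c ≠ 0 → ∀ x, cl (c • x) = cl x
  chord : ∀ x y, T.form x x x = 0 → T.form y y y = 0 → T.form x y y ≠ 0 →
    cl x + cl y + cl (T.third x y) = h
  tangent : ∀ x y, T.form x x x = 0 → T.form y y y = 0 → T.form x x y = 0 →
    LinearIndependent L ![x, y] → cl x + cl x + cl y = h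

/-- The function `cl` is constant near `P` on the surface. -/
def ConstNear {L H : Type*} [Field L] [TopologicalSpace L] (T : SymmTrilin (Fin 4) L)
    (cl : (Fin 4 → L) → H) (P : Fin 4 → L) : Prop :=
  ∀ᶠ Q in 𝓝 P, T.form Q Q Q = 0 → cl Q = cl P

theorem ConstNear.eventually {L H : Type*} [Field L] [TopologicalSpace L]
    {T : SymmTrilin (Fin 4) L} {cl : (Fin 4 → L) → H} {P : Fin 4 → L} (h : T.ConstNear cl P) :
    ∀ᶠ Q in 𝓝 P, T.form Q Q Q = 0 → T.ConstNear cl Q := by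
  filter_upwards [eventually_eventually_nhds.2 h] with Q hQ h0
  filter_upwards [hQ] with R hR hR0
  rw [hR hR0, hQ.self_of_nhds h0]

/-- If `cl` is constant near a point off the tangent plane at `B`, it is constant near `B`. -/
theorem IsClassMap.constNear_of_constNear {L H : Type*} [Field L] [TopologicalSpace L]
    [IsTopologicalRing L] [T1Space L] [AddCommGroup H] {T : SymmTrilin (Fin 4) L}
    {cl : (Fin 4 → L) → H} {h : H} (hcl : T.IsClassMap cl h) {B Q : Fin 4 → L}
    (hB : T.form B B B = 0) (hQ : T.form Q Q Q = 0) (hBQ : T.form B B Q ≠ 0)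
    (hgood : T.ConstNear cl Q) : T.ConstNear cl B := by
  -- `A` is the third point on the chord through Q and B. The chord through `A` and a point B' near
  -- B has its third point near Q; normalized by β³ it tends to the vector Q itself. Thus cl B' = h
  -- - cl A - cl Q.
  set β := T.form B B Q with hβ
  set A := T.third Q B
  have hβ' : T.form Q B B = β := by rw [form_swap_left, form_swap_right]
  have hA : T.form A A A = 0 := T.form_third_self hQ hB
  have hABB : T.form A B B = β ^ 2 := by
    simp only [A, third, form_sub_left, form_smul_left, hB, hβ']
    ring
  have hAAB : T.form A A B = -(T.form Q Q B * β ^ 2) := by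
    simp only [A]
    rw [form_third, hB, hβ']
    ring
  have hthird : T.third A B = β ^ 3 • Q := by
    rw [third, hABB, hAAB]
    simp only [A, third, hβ', smul_sub, smul_smul, neg_smul]
    module
  have hc : Continuous fun B' => (β ^ 3)⁻¹ • T.third A B' := by
    unfold third
    fun_prop
  have hc' : Continuous fun B' => T.form A B' B' := by fun_prop
  have hlim : (β ^ 3)⁻¹ • T.third A B = Q := by
    rw [hthird, smul_smul, inv_mul_cancel₀ (pow_ne_zero 3 hBQ), one_smul]
  have h1 : ∀ᶠ B' in 𝓝 B, T.form B' B' B' = 0 → cl B' = h - cl A - cl Q := by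
    have e1 := hc.continuousAt (x := B)
    rw [ContinuousAt, hlim] at e1
    filter_upwards [e1.eventually hgood, hc'.continuousAt.eventually_ne (x := B) (y := 0)
      (by rw [hABB]; exact pow_ne_zero 2 hBQ)] with B' h1 h2 h3
    have h4 := hcl.chord A B' hA h3 h2
    rw [← hcl.smul (β ^ 3)⁻¹ (inv_ne_zero (pow_ne_zero 3 hBQ)) (T.third A B'), h1] at h4
    · rw [← h4]; abel
    · simp only [form_smul_left, form_smul_mid, form_smul_right, T.form_third_self hA h3, mul_zero]
  filter_upwards [h1] with B' h2 h3
  rw [h2 h3, h1.self_of_nhds hB]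

/-! ### The tangent plane section as a polynomial curve -/

theorem exists_combination {ι L : Type*} [Field L] {P u₀ u₁ : ι → L}
    (hli : LinearIndependent L ![P, u₀, u₁])
    {a b c : L} (h : a • P + b • u₀ + c • u₁ = 0) : a = 0 ∧ b = 0 ∧ c = 0 := by
  have := Fintype.linearIndependent_iff.1 hli ![a, b, c] (by simpa [Fin.sum_univ_three] using h)
  exact ⟨this 0, this 1, this 2⟩

/-- A parametrization of the tangent plane section at `P`, in the tangent directions
`u₀ + s u₁`. -/
noncomputable def tangentCurve {ι L : Type*} [Fintype ι] [Field L] (T : SymmTrilin ι L)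
    (P u₀ u₁ : ι → L) : ι → L[X] :=
  (T.map Polynomial.C).residual (fun i => Polynomial.C (P i))
    fun i => Polynomial.C (u₀ i) + Polynomial.X * Polynomial.C (u₁ i)

theorem eval_tangentCurve {ι L : Type*} [Fintype ι] [Field L] (T : SymmTrilin ι L)
    (P u₀ u₁ : ι → L) (s : L) :
    (fun i => (T.tangentCurve P u₀ u₁ i).eval s) = T.residual P (u₀ + s • u₁) := by
  ext i
  simp only [tangentCurve, residual, Pi.sub_apply, Pi.smul_apply, smul_eq_mul,
    Polynomial.eval_sub, Polynomial.eval_mul, Polynomial.eval_C, Polynomial.eval_add,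
    Polynomial.eval_X, Polynomial.eval_ofNat, eval_form, Pi.add_apply]
  rfl

section Curve

variable {ι L : Type*} [Fintype ι] [Field L] [CharZero L] {T : SymmTrilin ι L}
  {E : Type*} [Field E] [Algebra L E] [IsAlgClosed E]

/-- The residual point has component -3 f(P,u,u) along u = u₀ + s u₁, so it differs from P when
f(P,u,u) ≠ 0. -/
theorem linearIndependent_residual {P u₀ u₁ : ι → L} (hli : LinearIndependent L ![P, u₀, u₁])
    {s : L} (hs : T.form P (u₀ + s • u₁) (u₀ + s • u₁) ≠ 0) :
    LinearIndependent L ![P, T.residual P (u₀ + s • u₁)] := by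
  rw [LinearIndependent.pair_iff]
  intro a b hab
  have h1 := exists_combination hli (a := a + b * T.form (u₀ + s • u₁) (u₀ + s • u₁) (u₀ + s • u₁))
    (b := -(b * (3 * T.form P (u₀ + s • u₁) (u₀ + s • u₁))))
    (c := -(b * (3 * T.form P (u₀ + s • u₁) (u₀ + s • u₁)) * s)) (by
      rw [← hab, residual]
      generalize T.form P (u₀ + s • u₁) (u₀ + s • u₁) = q
      generalize T.form (u₀ + s • u₁) (u₀ + s • u₁) (u₀ + s • u₁) = q'
      module)
  have hb : b = 0 := by simpa [hs] using h1.2.1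
  refine ⟨?_, hb⟩
  simpa [hb] using h1.1

/-- The tangent plane is not constant along the tangent plane section at `P`. -/
theorem Nonsingular.exists_tangentCurve_immersed [DecidableEq ι]
    (hT : (T.map (algebraMap L E)).Nonsingular)
    {P u₀ u₁ : ι → L} (hli : LinearIndependent L ![P, u₀, u₁]) (hP : T.form P u₀ u₀ ≠ 0) :
    ∃ s, T.form P (u₀ + s • u₁) (u₀ + s • u₁) ≠ 0 ∧
      ∃ i j, T.polar (T.residual P (u₀ + s • u₁)) (T.residual P (u₀ + s • u₁)) i *
          T.polar (T.residual P (u₀ + s • u₁))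
            (fun k => (Polynomial.derivative (T.tangentCurve P u₀ u₁ k)).eval s) j ≠
        T.polar (T.residual P (u₀ + s • u₁)) (T.residual P (u₀ + s • u₁)) j *
          T.polar (T.residual P (u₀ + s • u₁))
            (fun k => (Polynomial.derivative (T.tangentCurve P u₀ u₁ k)).eval s) i := by
  by_contra! h
  set A := T.tangentCurve P u₀ u₁ with hAdef
  let q : L[X] := (T.map Polynomial.C).form (fun i => Polynomial.C (P i))
    (fun i => Polynomial.C (u₀ i) + Polynomial.X * Polynomial.C (u₁ i))
    (fun i => Polynomial.C (u₀ i) + Polynomial.X * Polynomial.C (u₁ i))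
  have hq : ∀ s, q.eval s = T.form P (u₀ + s • u₁) (u₀ + s • u₁) := fun s => by
    simp only [q, eval_form, Polynomial.eval_C, Polynomial.eval_add, Polynomial.eval_mul,
      Polynomial.eval_X]
    rfl
  have hq0 : q ≠ 0 := fun h0 => hP (by simpa [h0] using (hq 0).symm)
  let Γ : ι → L[X] := (T.map Polynomial.C).polar A A
  -- The negated claim says that the gradient curve Γ has vanishing Wronskians wherever q ≠ 0. The
  -- factor q makes this an identity of polynomials, so Γ has constant direction φ.
  have hΓ : ∀ i j, Γ i * Polynomial.derivative (Γ j) = Γ j * Polynomial.derivative (Γ i) := by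
    intro i j
    refine mul_left_cancel₀ hq0 (Polynomial.funext fun s => ?_)
    by_cases hs : q.eval s = 0
    · simp [hs]
    · rw [hq] at hs
      have := h s hs i j
      simp only [Γ, derivative_polar, Polynomial.eval_mul, eval_polar, Polynomial.eval_ofNat]
      rw [eval_tangentCurve]
      linear_combination 2 * q.eval s * this
  have hA0 : ∀ s, q.eval s ≠ 0 → LinearIndependent L ![P, T.residual P (u₀ + s • u₁)] :=
    fun s hs => linearIndependent_residual hli (by rwa [hq] at hs)
  have hq00 : q.eval 0 ≠ 0 := by rw [hq]; simpa using hP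
  obtain ⟨i, hi⟩ : ∃ i, Γ i ≠ 0 := by
    by_contra! h0
    have := Nonsingular.of_map hT (T.residual P (u₀ + (0 : L) • u₁)) (by
      ext i
      have := congrArg (Polynomial.eval 0) (h0 i)
      simp only [Γ, eval_polar, Polynomial.eval_zero] at this
      rwa [eval_tangentCurve] at this)
    exact (hA0 0 hq00).ne_zero 1 this
  choose φ hφ using fun j => Polynomial.exists_eq_C_mul_of_wronskian_eq_zero hi (hΓ i j)
  have hφ0 : φ ≠ 0 := fun h0 => hi (by rw [hφ i, h0]; simp)
  -- A second parameter t ≠ 0 with q(t) ≠ 0: the points at 0 and t lie on different tangents through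
  -- P, hence are distinct, while a constant Gauss map would make them proportional.
  obtain ⟨t, ht⟩ : ∃ t, (q * Polynomial.X).eval t ≠ 0 := by
    by_contra! h0
    exact mul_ne_zero hq0 Polynomial.X_ne_zero (Polynomial.funext fun s => by simpa using h0 s)
  rw [Polynomial.eval_mul, Polynomial.eval_X] at ht
  have hqt := left_ne_zero_of_mul ht
  have hcomm := fun i j => hT.eval_mul_eval_comm hφ0 A (fun s i' j' => by
    rw [← eval_polar, ← eval_polar]
    change φ i' * (Γ j').eval s = φ j' * (Γ i').eval s
    rw [hφ j', hφ i', Polynomial.eval_mul, Polynomial.eval_mul, Polynomial.eval_C,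
      Polynomial.eval_C]
    ring) 0 t i j
  have h0 := congrFun (eval_tangentCurve T P u₀ u₁ 0)
  have h1 := congrFun (eval_tangentCurve T P u₀ u₁ t)
  simp only [← hAdef] at h0 h1
  refine not_linearIndependent_of_mul_comm (x := T.residual P (u₀ + (0 : L) • u₁))
    (y := T.residual P (u₀ + t • u₁)) (fun i j => ?_) ?_
  · rw [← h0, ← h0, ← h1, ← h1]
    exact hcomm i j
  · rw [LinearIndependent.pair_iff]
    intro a b hab
    rw [hq] at hq00 hqt
    have h2 := exists_combination hli
      (a := a * T.form (u₀ + (0 : L) • u₁) (u₀ + (0 : L) • u₁) (u₀ + (0 : L) • u₁) +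
        b * T.form (u₀ + t • u₁) (u₀ + t • u₁) (u₀ + t • u₁))
      (b := -(a * (3 * T.form P (u₀ + (0 : L) • u₁) (u₀ + (0 : L) • u₁)) +
        b * (3 * T.form P (u₀ + t • u₁) (u₀ + t • u₁))))
      (c := -(b * (3 * T.form P (u₀ + t • u₁) (u₀ + t • u₁)) * t)) (by
        rw [← hab, residual, residual]
        generalize T.form P (u₀ + t • u₁) (u₀ + t • u₁) = q1
        generalize T.form (u₀ + t • u₁) (u₀ + t • u₁) (u₀ + t • u₁) = q2
        generalize T.form P (u₀ + (0 : L) • u₁) (u₀ + (0 : L) • u₁) = q3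
        generalize T.form (u₀ + (0 : L) • u₁) (u₀ + (0 : L) • u₁) (u₀ + (0 : L) • u₁) = q4
        module)
    have hb : b = 0 := by simpa [hqt, right_ne_zero_of_mul ht] using h2.2.2
    refine ⟨?_, hb⟩
    have := h2.2.1
    rw [hb, zero_mul, add_zero, neg_eq_zero] at this
    exact (mul_eq_zero.1 this).resolve_right (mul_ne_zero three_ne_zero hq00)

end Curve

end SymmTrilin

/-! ### Local constancy of class maps -/

namespace SymmTrilin

theorem exists_tangent_linearIndependent {L : Type*} [Field L] (T : SymmTrilin (Fin 4) L)
    {P w : Fin 4 → L} (hP0 : P ≠ 0) (hP : T.form P P P = 0) (hPw : T.form P w w ≠ 0) :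
    ∃ u, T.form P P u = 0 ∧ LinearIndependent L ![P, w, u] := by
  obtain ⟨u, hu, huW⟩ := (T.formₗ P P).exists_mem_ker_notMem (Submodule.span L (Set.range ![P, w]))
    ((finrank_range_le_card _).trans (by simp))
  refine ⟨u, hu, ?_⟩
  have h2 : LinearIndependent L ![P, w] := by
    rw [LinearIndependent.pair_iff' hP0]
    rintro a rfl
    simp [form_smul_mid, form_smul_right, hP] at hPw
  have : ![P, w, u] = Fin.snoc ![P, w] u := by
    ext i : 1
    fin_cases i <;> rfl
  rw [this, linearIndependent_finSnoc]
  exact ⟨h2, huW⟩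

/-- Given a direction `v` which the second fundamental form at `P` does not kill, there is a point
on the tangent plane section at `P` not conjugate to `v`. -/
theorem exists_residual_form_ne_zero {ι L : Type*} [Fintype ι] [Field L] [CharZero L]
    (T : SymmTrilin ι L) {P v u : ι → L} (hP : T.form P P P = 0) (hv : T.form P P v = 0)
    (hu : T.form P P u = 0) (hvu : T.form P v u ≠ 0) :
    ∃ Q, T.form Q Q Q = 0 ∧ T.form P P Q = 0 ∧ T.form P v Q ≠ 0 := by
  -- For such w the residual point Q satisfies f(P,v,Q) = -3 f(P,w,w) f(P,v,w).
  suffices h : ∃ w, T.form P P w = 0 ∧ T.form P v w ≠ 0 ∧ T.form P w w ≠ 0 by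
    obtain ⟨w, hw, hvw, hww⟩ := h
    refine ⟨T.residual P w, T.form_residual_self hP hw, T.form_residual hP hw, ?_⟩
    rw [residual, form_sub_right, form_smul_right, form_smul_right, T.form_swap_right P v P, hv]
    simp [hvw, hww]
  by_cases h0 : T.form P u u = 0
  swap
  · exact ⟨u, hu, hvu, h0⟩
  -- When f(P,u,u) = 0, perturb u to u + t v. Take t = 1 if f(P,v,v) = 0; otherwise t =
  -- f(P,v,u)/f(P,v,v) turns the two factors into 2 f(P,v,u) and 3 f(P,v,u).
  have key : ∀ t, T.form P P (u + t • v) = 0 ∧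
      T.form P v (u + t • v) = T.form P v u + t * T.form P v v ∧
      T.form P (u + t • v) (u + t • v) = t * (2 * T.form P v u + t * T.form P v v) := by
    intro t
    simp only [form_add_right, form_add_mid, form_smul_right, form_smul_mid, hu, hv, h0,
      T.form_swap_right P u v]
    exact ⟨by ring, trivial, by ring⟩
  by_cases ha : T.form P v v = 0
  · obtain ⟨h1, h2, h3⟩ := key 1
    exact ⟨_, h1, by rw [h2]; simpa [ha] using hvu, by rw [h3]; simpa [ha] using hvu⟩
  · obtain ⟨h1, h2, h3⟩ := key (T.form P v u / T.form P v v)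
    refine ⟨_, h1, ?_, ?_⟩
    · rw [h2, div_mul_cancel₀ _ ha, ← two_mul]
      exact mul_ne_zero two_ne_zero hvu
    · rw [h3, div_mul_cancel₀ _ ha]
      refine mul_ne_zero (div_ne_zero hvu ha) ?_
      rw [show 2 * T.form P v u + T.form P v u = 3 * T.form P v u by ring]
      exact mul_ne_zero three_ne_zero hvu

variable {L : Type*} [NontriviallyNormedField L] [CompleteSpace L] [CharZero L]
  {T : SymmTrilin (Fin 4) L} {E : Type*} [Field E] [Algebra L E] [IsAlgClosed E]
  {H : Type*} [AddCommGroup H] {cl : (Fin 4 → L) → H} {h : H}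

/-- Two tangent steps from P: one parameter s for the point `a s` on the tangent section at P, then
the tangent section at `a s`. The resulting points sweep out a neighbourhood of some Q on the
surface, and all have class h - 2(h - 2 cl P). -/
theorem IsClassMap.exists_constNear (hcl : T.IsClassMap cl h)
    (hT : (T.map (algebraMap L E)).Nonsingular) {P : Fin 4 → L} (hP0 : P ≠ 0)
    (hP : T.form P P P = 0) {w : Fin 4 → L} (hw : T.form P P w = 0) (hPw : T.form P w w ≠ 0) :
    ∃ Q, Q ≠ 0 ∧ T.form Q Q Q = 0 ∧ T.ConstNear cl Q := by
  obtain ⟨u, hu, hli⟩ := T.exists_tangent_linearIndependent hP0 hP hPw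
  obtain ⟨s₀, hs₀, i, j, hij⟩ := hT.exists_tangentCurve_immersed hli hPw
  set A := T.tangentCurve P w u with hA
  let a : L → Fin 4 → L := fun s k => (A k).eval s
  let a' : L → Fin 4 → L := fun s k => (Polynomial.derivative (A k)).eval s
  have ha : ∀ s, a s = T.residual P (w + s • u) := eval_tangentCurve T P w u
  have htan : ∀ s, T.form P P (w + s • u) = 0 := fun s => by
    rw [form_add_right, form_smul_right, hw, hu, mul_zero, add_zero]
  have haF : ∀ s, T.form (a s) (a s) (a s) = 0 := fun s => by
    rw [ha]; exact T.form_residual_self hP (htan s)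
  have haP : ∀ s, T.form P P (a s) = 0 := fun s => by
    rw [ha]; exact T.form_residual hP (htan s)
  have haa' : ∀ s, T.form (a s) (a s) (a' s) = 0 := fun s => by
    have h0 : (T.map Polynomial.C).form A A A = 0 :=
      Polynomial.funext fun s => by simpa [eval_form] using haF s
    have := congrArg (Polynomial.eval s) (T.derivative_form_self A)
    simpa [h0, eval_form] using this.symm
  rw [← ha] at hij
  change T.polar (a s₀) (a s₀) i * T.polar (a s₀) (a' s₀) j ≠
    T.polar (a s₀) (a s₀) j * T.polar (a s₀) (a' s₀) i at hij
  -- The direction `u` is tangent at `a s₀` and f(a, a', u) ≠ 0 by `hij`. The resulting Q makes `s₀`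
  -- a simple root of s ↦ f(a s, a s, Q), so each R near Q lies in the tangent plane at some `a s`
  -- with s near `s₀`.
  obtain ⟨Q, hQ, haQ, hvQ⟩ := T.exists_residual_form_ne_zero (haF s₀) (haa' s₀)
    (u := T.polar (a s₀) (a s₀) i • Pi.single j 1 - T.polar (a s₀) (a s₀) j • Pi.single i 1)
    (by
      rw [form_sub_right, form_smul_right, form_smul_right]
      simp only [polar]
      ring)
    (by
      rw [form_sub_right, form_smul_right, form_smul_right]
      exact sub_ne_zero.2 hij)
  have hQ0 : Q ≠ 0 := by
    rintro rfl
    exact hvQ (by simpa using T.form_smul_right 0 (a s₀) (a' s₀) 0)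
  have hpc : ∀ p : L[X], ContDiff L ω fun s => p.eval s := fun p => by
    simpa using p.contDiff_aeval (𝕜 := L) ω
  have hΦ : ContDiff L ω fun z : (Fin 4 → L) × L => T.form (a z.2) (a z.2) z.1 := by
    have h1 : ∀ k, ContDiff L ω fun z : (Fin 4 → L) × L => a z.2 k := fun k =>
      (hpc (A k)).comp contDiff_snd
    have h2 : ∀ k, ContDiff L ω fun z : (Fin 4 → L) × L => z.1 k := fun k => by fun_prop
    unfold form
    fun_prop
  have hd : HasDerivAt (fun t => T.form (a t) (a t) Q) (2 * T.form (a s₀) (a' s₀) Q) s₀ := by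
    have := ((T.map Polynomial.C).form A A fun i => Polynomial.C (Q i)).hasDerivAt s₀
    rw [derivative_form_const] at this
    simpa [eval_form] using this
  have hac : Continuous a := continuous_pi fun k => (A k).continuous
  have hac' : Continuous a' := continuous_pi fun k => (Polynomial.derivative (A k)).continuous
  have hnear : ∀ᶠ z in 𝓝 (Q, s₀), T.form P (w + z.2 • u) (w + z.2 • u) ≠ 0 ∧
      T.form (a z.2) (a' z.2) z.1 ≠ 0 := by
    have c1 : Continuous fun z : (Fin 4 → L) × L => T.form P (w + z.2 • u) (w + z.2 • u) := by
      fun_prop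
    have c2 : Continuous fun z : (Fin 4 → L) × L => T.form (a z.2) (a' z.2) z.1 := by fun_prop
    exact (c1.continuousAt.eventually_ne (x := (Q, s₀)) hs₀).and
      (c2.continuousAt.eventually_ne (x := (Q, s₀)) hvQ)
  rw [nhds_prod_eq, Filter.eventually_prod_iff] at hnear
  obtain ⟨pa, hpa, pb, hpb, hab⟩ := hnear
  have hroot := eventually_exists_root hΦ haQ hd (mul_ne_zero two_ne_zero hvQ) hpb
  have hconst : ∀ᶠ R in 𝓝 Q, T.form R R R = 0 → cl R = h - (h - (cl P + cl P)) -
      (h - (cl P + cl P)) := by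
    filter_upwards [hpa, hroot] with R hR ⟨s, hs, h0⟩ hRF
    obtain ⟨h1, h2⟩ := hab hR hs
    have hli1 : LinearIndependent L ![P, a s] := by
      rw [ha]; exact linearIndependent_residual hli h1
    have e1 := hcl.tangent P (a s) hP (haF s) (haP s) hli1
    -- R cannot be a multiple of `a s`, because f(a, a', R) ≠ 0 while f(a, a', a) = 0.
    have hli2 : LinearIndependent L ![a s, R] := by
      have has : a s ≠ 0 := hli1.ne_zero 1
      rw [LinearIndependent.pair_iff' has]
      rintro c rfl
      dsimp only at h2
      rw [form_smul_right, form_swap_right, haa', mul_zero] at h2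
      exact h2 rfl
    have e2 := hcl.tangent (a s) R (haF s) hRF h0 hli2
    rw [show h - (cl P + cl P) = cl (a s) by rw [← e1]; abel, ← e2]
    abel
  refine ⟨Q, hQ0, hQ, ?_⟩
  filter_upwards [hconst] with R h1 h2
  rw [h1 h2, hconst.self_of_nhds hQ]

/-- On a smooth cubic surface over a complete field of characteristic zero, the class of a point
is locally constant. -/
theorem IsClassMap.constNear (hcl : T.IsClassMap cl h)
    (hT : (T.map (algebraMap L E)).Nonsingular) {P : Fin 4 → L} (hP0 : P ≠ 0)
    (hP : T.form P P P = 0) : T.ConstNear cl P := by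
  have hne : ∀ {P : Fin 4 → L}, P ≠ 0 → {Q : Fin 4 → L | Q ≠ 0} ∈ 𝓝 P := fun hP =>
    isOpen_ne.mem_nhds hP
  -- Non-Eckardt points serve twice: `P₁` starts the two tangent steps, and `Q₁` lets one leave the
  -- tangent plane at P inside the region of local constancy.
  obtain ⟨P₁, hP₁0, hP₁, w, hw, hPw⟩ := hT.exists_not_eckardt hP0 hP (hne hP0)
  obtain ⟨Q, hQ0, hQ, hgood⟩ := hcl.exists_constNear hT hP₁0 hP₁ hw hPw
  obtain ⟨Q₁, ⟨hQ₁0, hQ₁good⟩, hQ₁, w₁, hw₁, hQw₁⟩ := hT.exists_not_eckardt hQ0 hQ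
    (Filter.inter_mem (hne hQ0) hgood.eventually)
  have hφ : T.formₗ P P ≠ 0 := fun h0 => by
    obtain ⟨e, he⟩ := (Nonsingular.of_map hT).exists_form_ne_zero hP0
    exact he (LinearMap.congr_fun h0 e)
  obtain ⟨R, hRgood, hR, hPR⟩ := hT.exists_notMem_plane hQ₁0 hQ₁ hw₁ hQw₁
    (hQ₁good hQ₁).eventually (T.formₗ P P) hφ
  exact hcl.constNear_of_constNear hP hR hPR (hRgood hR)

end SymmTrilin

/-! ### Polarization of a cubic form and smoothness over extensions -/

theorem MvPolynomial.pderiv_pderiv_comm {σ R : Type*} [CommRing R] (i j : σ)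
    (p : MvPolynomial σ R) : pderiv i (pderiv j p) = pderiv j (pderiv i p) := by
  classical
  have h : ⁅(pderiv i : Derivation R (MvPolynomial σ R) _), pderiv j⁆ = 0 :=
    derivation_ext fun k => by
      change pderiv i (pderiv j (X k : MvPolynomial σ R)) -
        pderiv j (pderiv i (X k : MvPolynomial σ R)) = 0
      simp only [pderiv_X, Pi.single_apply]
      split_ifs <;> simp
  exact sub_eq_zero.1 (congrArg (fun D => D p) h)

theorem MvPolynomial.sum_mul_aeval_pderiv {σ R A : Type*} [Fintype σ] [CommRing R]
    [CommRing A] [Algebra R A] {p : MvPolynomial σ R} {n : ℕ} (hp : p.IsHomogeneous n)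
    (x : σ → A) : ∑ i, x i * aeval x (pderiv i p) = n * aeval x p := by
  simpa using congrArg (aeval x) hp.sum_X_mul_pderiv

namespace CubicForm

section Trilin

variable {L : Type*} [Field L] (S : CubicForm L)

/-- The symmetric trilinear form polarizing a cubic form. -/
noncomputable def trilin : SymmTrilin (Fin 4) L where
  coeff i j k := (1 / 6) * coeff 0 (pderiv k (pderiv j (pderiv i S.poly)))
  swap_left i j k := by rw [pderiv_pderiv_comm j i]
  swap_right i j k := by rw [pderiv_pderiv_comm j k]

variable [CharZero L] {A : Type*} [Field A] [Algebra L A]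

/-- Third partials of a cubic are constants. Euler's identity for the second and then the first
partials recovers the gradient, which is 3 f(x,x,·). -/
theorem polar_trilin (x : Fin 4 → A) (i : Fin 4) :
    3 * (S.trilin.map (algebraMap L A)).polar x x i = aeval x (pderiv i S.poly) := by
  have : CharZero A := charZero_of_injective_algebraMap (algebraMap L A).injective
  have h1 : (pderiv i S.poly).IsHomogeneous 2 := S.isHomogeneous.pderiv
  have h2 : ∀ j, (pderiv j (pderiv i S.poly)).IsHomogeneous 1 := fun j => h1.pderiv
  have h3 : ∀ j k, aeval x (pderiv k (pderiv j (pderiv i S.poly))) =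
      algebraMap L A (coeff 0 (pderiv k (pderiv j (pderiv i S.poly)))) := by
    intro j k
    have h4 : (pderiv k (pderiv j (pderiv i S.poly))).totalDegree = 0 :=
      Nat.le_zero.1 (h2 j).pderiv.totalDegree_le
    conv_lhs => rw [totalDegree_eq_zero_iff_eq_C.1 h4]
    simp
  have e1 := sum_mul_aeval_pderiv h1 x
  have e2 : ∀ j, _ := fun j => sum_mul_aeval_pderiv (h2 j) x
  simp only [h3] at e2
  push_cast at e1 e2
  rw [SymmTrilin.polar, SymmTrilin.form_swap_right, SymmTrilin.form_swap_left]
  simp only [SymmTrilin.form, SymmTrilin.map, trilin]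
  rw [Finset.sum_eq_single i (fun b _ hb => by simp [hb]) (by simp)]
  simp only [Pi.single_eq_same, one_mul, map_mul, map_div₀, map_one, map_ofNat]
  have e3 : ∀ j, ∑ k, 1 / 6 * algebraMap L A (coeff 0 (pderiv k (pderiv j (pderiv i S.poly)))) *
      (x j * x k) = 1 / 6 * (x j * aeval x (pderiv j (pderiv i S.poly))) := by
    intro j
    have := e2 j
    rw [one_mul] at this
    rw [← this, Finset.mul_sum, Finset.mul_sum]
    exact Finset.sum_congr rfl fun k _ => by ring
  simp only [e3]
  rw [← Finset.mul_sum, e1]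
  ring

theorem form_trilin (x : Fin 4 → L) : S.trilin.form x x x = eval x S.poly := by
  have h := sum_mul_aeval_pderiv S.isHomogeneous x
  have h1 := S.polar_trilin x
  simp only [Algebra.algebraMap_self, SymmTrilin.map_id, ← h1] at h
  rw [SymmTrilin.form_eq_sum_polar]
  have h2 : (3 : L) * ∑ i, x i * S.trilin.polar x x i = 3 * eval x S.poly := by
    rw [Finset.mul_sum, ← coe_aeval_eq_eval]
    push_cast at h
    rw [RingHom.coe_coe, ← h]
    exact Finset.sum_congr rfl fun i _ => by ring
  exact mul_left_cancel₀ three_ne_zero h2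

end Trilin

section Smooth

variable {K : Type*} [Field K] {S : CubicForm K}

/-- A smooth cubic form has no singular zeros in any extension field. -/
theorem IsSmooth.eq_zero [CharZero K] (hS : S.IsSmooth) {E : Type*} [Field E] [Algebra K E]
    {x : Fin 4 → E}
    (hx : ∀ i, aeval x (pderiv i S.poly) = 0) : x = 0 := by
  set I : Ideal (MvPolynomial (Fin 4) K) := Ideal.span (Set.range fun i => pderiv i S.poly)
  have hI : ∀ p ∈ I, aeval x p = 0 := by
    have : I ≤ RingHom.ker (aeval x : MvPolynomial (Fin 4) K →ₐ[K] E) := by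
      refine Ideal.span_le.2 ?_
      rintro _ ⟨i, rfl⟩
      exact hx i
    exact fun p hp => this hp
  ext i
  -- By Euler's identity and smoothness the partials have no nonzero common zero over the algebraic
  -- closure. The Nullstellensatz puts a power of each coordinate in their ideal over K, a fact that
  -- passes to every extension.
  have hX : (X i : MvPolynomial (Fin 4) K) ∈ I.radical := by
    rw [← vanishingIdeal_zeroLocus_eq_radical (K := AlgebraicClosure K)]
    intro y hy
    have hy' : ∀ i, aeval y (pderiv i S.poly) = 0 := fun i =>
      hy _ (Ideal.subset_span ⟨i, rfl⟩)
    suffices y = 0 by simp [this]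
    by_contra hy0
    have h3 := sum_mul_aeval_pderiv S.isHomogeneous y
    simp only [hy', mul_zero, Finset.sum_const_zero] at h3
    have : CharZero (AlgebraicClosure K) :=
      charZero_of_injective_algebraMap (algebraMap K _).injective
    obtain ⟨i, hi⟩ := hS y hy0 (by simpa using h3.symm)
    exact hi (hy' i)
  obtain ⟨n, hn⟩ := hX
  have := hI _ hn
  rw [map_pow, aeval_X] at this
  exact eq_zero_of_pow_eq_zero this

theorem IsSmooth.nonsingular_baseChange [CharZero K] (hS : S.IsSmooth) (L : Type*) [Field L]
    [CharZero L]
    [Algebra K L] (E : Type*) [Field E] [Algebra L E] :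
    ((S.baseChange L).trilin.map (algebraMap L E)).Nonsingular := by
  intro x hx
  let _ : Algebra K E := ((algebraMap L E).comp (algebraMap K L)).toAlgebra
  have : IsScalarTower K L E := IsScalarTower.of_algebraMap_eq fun _ => rfl
  refine hS.eq_zero fun i => ?_
  have := (S.baseChange L).polar_trilin x i
  rw [hx, Pi.zero_apply, mul_zero] at this
  rw [← aeval_map_algebraMap L, ← pderiv_map]
  exact this.symm

end Smooth

end CubicForm

/-! ### Point classes as a class map on coordinate vectors -/

theorem SymmTrilin.linearIndependent_of_form_ne_zero {L : Type*} [Field L] {T : SymmTrilin (Fin 4) L}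
    {x y : Fin 4 → L} (hx : T.form x x x = 0) (hy : T.form y y y = 0) (hxy : T.form x y y ≠ 0) :
    LinearIndependent L ![x, y] := by
  have hx0 : x ≠ 0 := by
    rintro rfl
    refine hxy ?_
    simpa using T.form_smul_left 0 y y 0
  rw [LinearIndependent.pair_iff' hx0]
  rintro c rfl
  simp [SymmTrilin.form_smul_mid, SymmTrilin.form_smul_right, hx] at hxy

namespace CubicForm

variable {L : Type*} [Field L] (S : CubicForm L)

theorem degG_single (P : S.Points) (n : ℤ) : S.degG (Finsupp.single P n) = n := by
  simp [degG]

/-- The class of a point in `H_S`. -/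
noncomputable def pointClass (P : S.Points) : S.H := QuotientAddGroup.mk (Finsupp.single P 1)

theorem deg_pointClass (P : S.Points) : S.deg (S.pointClass P) = 1 :=
  S.degG_single P 1

/-- All collinear triples have the same class. -/
theorem exists_pointClass_add_add : ∃ h : S.H, ∀ P Q R : S.Points,
    IsLineSection P Q R ∨ OnContainedLine P Q R →
      S.pointClass P + S.pointClass Q + S.pointClass R = h := by
  by_cases hex : ∃ P Q R : S.Points, IsLineSection P Q R ∨ OnContainedLine P Q R
  swap
  · push Not at hex
    exact ⟨0, fun P Q R h => absurd h (by simpa using hex P Q R)⟩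
  obtain ⟨P₀, Q₀, R₀, h₀⟩ := hex
  refine ⟨S.pointClass P₀ + S.pointClass Q₀ + S.pointClass R₀, fun P Q R h => ?_⟩
  simp only [pointClass]
  rw [← QuotientAddGroup.mk_add, ← QuotientAddGroup.mk_add, ← QuotientAddGroup.mk_add,
    ← QuotientAddGroup.mk_add, QuotientAddGroup.eq]
  have hmem : ∀ {P Q R : S.Points}, IsLineSection P Q R ∨ OnContainedLine P Q R →
      (Finsupp.single P 1 + Finsupp.single Q 1 + Finsupp.single R 1 : S.G) ∈ S.G' :=
    fun {P Q R} h => AddSubgroup.subset_closure ⟨P, Q, R, h, rfl⟩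
  refine AddSubgroup.mem_inf.2 ⟨add_mem (neg_mem (hmem h)) (hmem h₀), ?_⟩
  rw [AddMonoidHom.mem_ker]
  simp only [map_add, map_neg, degG_single]
  norm_num

variable {S}

/-- The point of the surface with given homogeneous coordinates. -/
def Points.mk (x : Fin 4 → L) (hx : x ≠ 0) (h : eval x S.poly = 0) : S.Points :=
  ⟨Projectivization.mk L x hx, fun y hy => by
    rw [Projectivization.submodule_mk, Submodule.mem_span_singleton] at hy
    obtain ⟨t, rfl⟩ := hy
    rw [eval_smul, h, mul_zero]⟩

theorem Points.mk_smul {c : L} {x : Fin 4 → L} (hx : x ≠ 0)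
    (h : eval x S.poly = 0) (hcx : c • x ≠ 0) (hc' : eval (c • x) S.poly = 0) :
    Points.mk (c • x) hcx hc' = Points.mk x hx h :=
  Subtype.ext ((Projectivization.mk_eq_mk_iff' L _ _ hcx hx).2 ⟨c, rfl⟩)

theorem Points.hasParam_mk {x p q : Fin 4 → L} {a : Fin 2 → L} (hx : x ≠ 0)
    (h : eval x S.poly = 0) (e : a 0 • p + a 1 • q = x) : (Points.mk x hx h).HasParam p q a := by
  unfold HasParam Points.mk
  rw [Projectivization.submodule_mk, e]

theorem Points.exists_eq_mk (P : S.Points) : ∃ x hx h, P = Points.mk x hx h := by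
  obtain ⟨P, hP⟩ := P
  induction P using Projectivization.ind with
  | h v hv => exact ⟨v, hv, hP v (by simp), rfl⟩

variable (S) in
open Classical in
/-- The class of the point with given homogeneous coordinates, with value zero at vectors which
do not give a point of the surface. -/
noncomputable def vectorClass (x : Fin 4 → L) : S.H :=
  if h : x ≠ 0 ∧ eval x S.poly = 0 then S.pointClass (Points.mk x h.1 h.2) else 0

theorem vectorClass_of_ne_zero {x : Fin 4 → L} (hx : x ≠ 0) (h : eval x S.poly = 0) :
    S.vectorClass x = S.pointClass (Points.mk x hx h) :=
  dif_pos ⟨hx, h⟩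

theorem vectorClass_smul {c : L} (hc : c ≠ 0) (x : Fin 4 → L) :
    S.vectorClass (c • x) = S.vectorClass x := by
  by_cases h : x ≠ 0 ∧ eval x S.poly = 0
  · have h1 : c • x ≠ 0 := smul_ne_zero hc h.1
    have h2 : eval (c • x) S.poly = 0 := by rw [eval_smul, h.2, mul_zero]
    rw [vectorClass_of_ne_zero h.1 h.2, vectorClass_of_ne_zero h1 h2, Points.mk_smul]
  · have h' : ¬(c • x ≠ 0 ∧ eval (c • x) S.poly = 0) := by
      rw [eval_smul]
      simpa [hc] using h
    rw [vectorClass, vectorClass, dif_neg h, dif_neg h']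

theorem eval_restrict (p q : Fin 4 → L) (s : Fin 2 → L) :
    eval s (S.restrict p q) = eval (s 0 • p + s 1 • q) S.poly := by
  unfold restrict
  have : (eval s).comp (aeval fun i => C (p i) * X 0 + C (q i) * X 1 :
      MvPolynomial (Fin 4) L →ₐ[L] MvPolynomial (Fin 2) L).toRingHom =
      eval (s 0 • p + s 1 • q) := by
    refine MvPolynomial.ringHom_ext (fun r => by simp) fun i => ?_
    simp [mul_comm]
  exact RingHom.congr_fun this S.poly

/-- Images of neighbourhoods of a coordinate vector are neighbourhoods of the point. -/
theorem eventually_points [TopologicalSpace L] [IsTopologicalRing L] {x : Fin 4 → L}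
    (hx : x ≠ 0) (h : eval x S.poly = 0) {p : S.Points → Prop}
    (hp : ∀ᶠ y in 𝓝 x, ∀ hy h', p (Points.mk y hy h')) :
    ∀ᶠ P in 𝓝 (Points.mk x hx h), p P := by
  obtain ⟨V, hV, hVo, hxV⟩ := eventually_nhds_iff.1 hp
  let W : Set (ℙ L (Fin 4 → L)) := {Q | ∃ y ∈ V, ∃ hy, Projectivization.mk L y hy = Q}
  have hW : IsOpen[TopologicalSpace.coinduced (Projectivization.mk' L (V := Fin 4 → L))
      inferInstance] W := by
    rw [isOpen_coinduced]
    -- The cone over W is a union of scalar multiples of the open set V, hence open, which is what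
    -- the quotient topology asks for.
    have : Projectivization.mk' L (V := Fin 4 → L) ⁻¹' W =
        ⋃ c : Lˣ, {v : {v : Fin 4 → L // v ≠ 0} | c • (v : Fin 4 → L) ∈ V} := by
      ext v
      simp only [W, Set.mem_preimage, Set.mem_ofPred_eq, Set.mem_iUnion]
      rw [Projectivization.mk'_eq_mk]
      constructor
      · rintro ⟨y, hy, hy0, e⟩
        obtain ⟨c, rfl⟩ := (Projectivization.mk_eq_mk_iff L _ _ _ _).1 e
        exact ⟨c, hy⟩
      · rintro ⟨c, hc⟩
        exact ⟨_, hc, smul_ne_zero c.ne_zero v.2,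
          (Projectivization.mk_eq_mk_iff L _ _ _ _).2 ⟨c, rfl⟩⟩
    rw [this]
    refine isOpen_iUnion fun c => hVo.preimage ?_
    simp only [Units.smul_def]
    fun_prop
  have hWo : IsOpen (Subtype.val ⁻¹' W : Set S.Points) := ⟨W, hW, rfl⟩
  filter_upwards [hWo.mem_nhds ⟨x, hxV, hx, rfl⟩] with P hP
  obtain ⟨y, hyV, hy, e⟩ := hP
  have h' : eval y S.poly = 0 := P.2 y (by rw [← e]; simp)
  have : P = Points.mk y hy h' := Subtype.ext e.symm
  rw [this]
  exact hV y hyV hy h'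

variable [CharZero L]

/-- The linear factor vanishes at the parameter of `third x y`; this identifies the divisor on a
chord, and shows when the line lies in the surface. -/
theorem restrict_eq {x y : Fin 4 → L} (hx : S.trilin.form x x x = 0)
    (hy : S.trilin.form y y y = 0) : S.restrict x y =
      C 3 * (X 0 * X 1 * (C (S.trilin.form x x y) * X 0 + C (S.trilin.form x y y) * X 1)) := by
  refine MvPolynomial.funext fun s => ?_
  rw [eval_restrict, ← form_trilin, SymmTrilin.form_comb_self, hx, hy]
  simp only [map_mul, eval_C, eval_X, map_add]
  ring

theorem exists_isClassMap_vectorClass : ∃ h, S.trilin.IsClassMap S.vectorClass h := by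
  obtain ⟨h, hh⟩ := S.exists_pointClass_add_add
  have hchord : ∀ x y, S.trilin.form x x x = 0 → S.trilin.form y y y = 0 →
      S.trilin.form x y y ≠ 0 →
      S.vectorClass x + S.vectorClass y + S.vectorClass (S.trilin.third x y) = h := by
    intro x y hx hy hxy
    have hli := SymmTrilin.linearIndependent_of_form_ne_zero hx hy hxy
    have hx0 : x ≠ 0 := hli.ne_zero 0
    have hy0 : y ≠ 0 := hli.ne_zero 1
    have hz := S.trilin.form_third_self hx hy
    have hz0 : S.trilin.third x y ≠ 0 := fun h0 => hxy <| by
      rw [LinearIndependent.pair_iff] at hli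
      refine (hli (S.trilin.form x y y) (-S.trilin.form x x y) ?_).1
      rw [neg_smul, ← sub_eq_add_neg]
      exact h0
    have ex := hx
    have ey := hy
    rw [form_trilin] at hz ex ey
    rw [vectorClass_of_ne_zero hx0 ex, vectorClass_of_ne_zero hy0 ey, vectorClass_of_ne_zero hz0 hz]
    refine hh _ _ _ (Or.inl ⟨x, y, hli, ![1, 0], ![0, 1],
      ![S.trilin.form x y y, -S.trilin.form x x y], Points.hasParam_mk _ _ (by simp),
      Points.hasParam_mk _ _ (by simp), Points.hasParam_mk _ _ ?_, 3, three_ne_zero, ?_⟩)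
    · simp [SymmTrilin.third, sub_eq_add_neg]
    · rw [restrict_eq hx hy]
      simp only [vanishAt, Matrix.cons_val_zero, Matrix.cons_val_one, map_zero, map_one, map_neg]
      ring
  refine ⟨h, fun c hc x => vectorClass_smul hc x, hchord, ?_⟩
  intro x y hx hy hxy hli
  have hx0 : x ≠ 0 := hli.ne_zero 0
  have hy0 : y ≠ 0 := hli.ne_zero 1
  -- With f(x,x,y) = 0 there are two cases: either f(x,y,y) = 0 and the line lies in the surface, or
  -- `third x y` is a nonzero multiple of x and the chord relation reads 2[x] + [y] = h.
  by_cases h0 : S.trilin.form x y y = 0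
  · have ex := hx
    have ey := hy
    rw [form_trilin] at ex ey
    rw [vectorClass_of_ne_zero hx0 ex, vectorClass_of_ne_zero hy0 ey]
    refine hh _ _ _ (Or.inr ⟨x, y, hli, ?_, ![1, 0], ![1, 0], ![0, 1],
      Points.hasParam_mk _ _ (by simp), Points.hasParam_mk _ _ (by simp),
      Points.hasParam_mk _ _ (by simp)⟩)
    rw [restrict_eq hx hy, hxy, h0]
    simp
  · rw [← hchord x y hx hy h0, SymmTrilin.third, hxy, zero_smul, sub_zero, vectorClass_smul h0]
    abel

/-- On a smooth cubic surface over a complete field of characteristic zero, the class of a point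
is locally constant. -/
theorem eventually_pointClass_eq {F : Type*} [NontriviallyNormedField F] [CompleteSpace F]
    [CharZero F] {S : CubicForm F}
    (hS : (S.trilin.map (algebraMap F (AlgebraicClosure F))).Nonsingular) (P : S.Points) :
    ∀ᶠ Q in 𝓝 P, S.pointClass Q = S.pointClass P := by
  obtain ⟨x, hx, h, rfl⟩ := P.exists_eq_mk
  obtain ⟨c, hc⟩ := exists_isClassMap_vectorClass (S := S)
  refine eventually_points hx h ?_
  filter_upwards [hc.constNear hS hx (by rw [form_trilin, h])] with y hy hy0 h'
  rw [← vectorClass_of_ne_zero, ← vectorClass_of_ne_zero]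
  exact hy (by rw [form_trilin, h'])

end CubicForm

/-! ### Generators of `H0` and weak approximation for classes -/

namespace CubicForm

section Generation

variable {K : Type*} [Field K] (S : CubicForm K)

/-- The class of the difference of two points. -/
noncomputable def pointSub (P Q : S.Points) : S.H0 :=
  ⟨S.pointClass P - S.pointClass Q, AddMonoidHom.mem_ker.2 <| by
    rw [map_sub, deg_pointClass, deg_pointClass, sub_self]⟩

theorem coe_mapH0_pointSub (L : Type*) [Field L] [Algebra K L] (P Q : S.Points) :
    (S.mapH0 L (S.pointSub P Q) : (S.baseChange L).H) =
      (S.baseChange L).pointClass (S.mapPoints L P) -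
        (S.baseChange L).pointClass (S.mapPoints L Q) := by
  have h : ∀ P, S.mapH L (S.pointClass P) = (S.baseChange L).pointClass (S.mapPoints L P) :=
    fun P => congrArg _ (S.mapG_single L P 1)
  change S.mapH L (S.pointClass P - S.pointClass Q) = _
  rw [map_sub, h, h]

/-- The degree zero part is generated by the differences with a fixed base point. -/
theorem mem_of_pointSub_mem {N : AddSubgroup S.H0} {O : S.Points}
    (hN : ∀ P, S.pointSub P O ∈ N) (D : S.H0) : D ∈ N := by
  have key : ∀ d : S.G, (QuotientAddGroup.mk d : S.H) - S.degG d • S.pointClass O ∈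
      N.map S.H0.subtype := by
    intro d
    induction d using Finsupp.induction_linear with
    | zero => simp [zero_mem]
    | add f g hf hg =>
      have := add_mem hf hg
      rw [map_add, add_zsmul, QuotientAddGroup.mk_add]
      convert! this using 1
      abel
    | single P n =>
      have h1 : (Finsupp.single P n : S.G) = n • Finsupp.single P 1 := by simp
      rw [degG_single, h1, QuotientAddGroup.mk_zsmul]
      change n • S.pointClass P - n • S.pointClass O ∈ _
      rw [← zsmul_sub]
      exact zsmul_mem (AddSubgroup.mem_map.2 ⟨_, hN P, rfl⟩) n
  obtain ⟨D, hD⟩ := D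
  induction D using QuotientAddGroup.induction_on with
  | H d =>
    have h0 : S.degG d = 0 := AddMonoidHom.mem_ker.1 hD
    have := key d
    rw [h0, zero_zsmul, sub_zero] at this
    obtain ⟨D', hD', e⟩ := this
    rwa [← show D' = ⟨_, hD⟩ from Subtype.ext e]

end Generation

section Global

variable {K : Type*} [Field K] [NumberField K] {S : CubicForm K}

/-- The class of a `K_v`-point is locally constant. -/
theorem IsSmooth.eventually_pointClass_eq (hS : S.IsSmooth) (v : Place K)
    (P : (S.baseChange v.Completion).Points) :
    ∀ᶠ Q in 𝓝 P, (S.baseChange v.Completion).pointClass Q =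
      (S.baseChange v.Completion).pointClass P := by
  rcases v with v | v
  · let _ : NontriviallyNormedField v.Completion :=
      -- At an infinite place the element 2 has absolute value 2 > 1.
      { non_trivial := ⟨((2 : WithAbs v.1) : v.Completion), by
          rw [NumberField.InfinitePlace.Completion.norm_coe, map_ofNat,
            ← NumberField.InfinitePlace.norm_embedding_eq]
          rw [map_ofNat v.embedding 2]
          norm_num⟩ }
    have : CharZero v.Completion := charZero_of_injective_algebraMap
      (algebraMap K v.Completion).injective
    exact CubicForm.eventually_pointClass_eq (F := v.Completion)
      (hS.nonsingular_baseChange v.Completion _) P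
  · let _ : NontriviallyNormedField (v.adicCompletion K) :=
      Valued.toNontriviallyNormedField (v.adicCompletion K) (WithZero (Multiplicative ℤ))
    have : CharZero (v.adicCompletion K) := charZero_of_injective_algebraMap
      (algebraMap K (v.adicCompletion K)).injective
    exact CubicForm.eventually_pointClass_eq (F := v.adicCompletion K)
      (hS.nonsingular_baseChange (v.adicCompletion K) _) P

/-- Weak approximation for classes: a tuple of classes of local points at finitely many places is
the tuple of classes of a rational point. -/
theorem IsSmooth.exists_pointClass_eq (hS : S.IsSmooth) (hne : Nonempty (S.AdelicPoints ∅))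
    {T : Set (Place K)} (hdense : DenseRange (S.toAdelicPoints T)) {Δ : Finset (Place K)}
    (hΔ : ∀ v ∈ Δ, v ∉ T) (P : ∀ v : Δ, (S.baseChange (v : Place K).Completion).Points) :
    ∃ Q : S.Points, ∀ v : Δ, (S.baseChange (v : Place K).Completion).pointClass
      (S.mapPoints (v : Place K).Completion Q) =
        (S.baseChange (v : Place K).Completion).pointClass (P v) := by
  classical
  obtain ⟨x⟩ := hne
  -- The given adelic point fills the places outside Δ. Integrality is automatic, since every point
  -- of projective space over `K_v` has primitive coordinates.
  let y : S.AdelicPoints T := ⟨fun v => if h : (v : Place K) ∈ Δ then P ⟨v, h⟩ else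
    x ⟨v, Set.notMem_empty _⟩, .of_forall fun _ => S.mem_integralPoints _ _⟩
  have hy : ∀ v : Δ, y ⟨v, hΔ v v.2⟩ = P v := fun v => dif_pos v.2
  have h : ∀ᶠ z in 𝓝 y, ∀ v : Δ, (S.baseChange (v : Place K).Completion).pointClass
      (z ⟨v, hΔ v v.2⟩) = (S.baseChange (v : Place K).Completion).pointClass (P v) := by
    rw [Filter.eventually_all]
    intro v
    have hc := (RestrictedProduct.continuous_eval (R := fun v : {v : Place K // v ∉ T} =>
      (S.baseChange (v : Place K).Completion).Points) (A := fun v => S.integralPoints v)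
      (𝓕 := Filter.cofinite) ⟨v, hΔ v v.2⟩).continuousAt (x := y)
    refine hc.eventually (p := fun Q => (S.baseChange (v : Place K).Completion).pointClass Q =
      (S.baseChange (v : Place K).Completion).pointClass (P v)) ?_
    rw [← hy v]
    exact hS.eventually_pointClass_eq v _
  obtain ⟨Q, hQ⟩ := hdense.exists_mem_open isOpen_interior ⟨y, mem_interior_iff_mem_nhds.2 h⟩
  exact ⟨Q, interior_subset hQ⟩

end Global

end CubicForm

theorem theorem10 {K : Type*} [Field K] [NumberField K]
    (S : CubicForm K) (hS : S.IsSmooth)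
    (hne : Nonempty (S.AdelicPoints ∅))
    (T : Set (Place K)) (hdense : DenseRange (S.toAdelicPoints T))
    (Δ : Finset (Place K)) (hΔ : ∀ v ∈ Δ, v ∉ T) :
    Function.Surjective (S.diagonalH0 Δ) := by
  classical
  have happrox := fun P => hS.exists_pointClass_eq hne hdense hΔ P
  obtain ⟨x⟩ := hne
  -- Only the existence of a rational point matters here; it serves as base point at every place.
  obtain ⟨O, -⟩ := happrox fun v => x ⟨v, Set.notMem_empty _⟩
  rw [← AddMonoidHom.range_eq_top, AddSubgroup.eq_top_iff']
  intro D
  rw [← Finset.univ_sum_single D]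
  refine sum_mem fun v _ => ?_
  refine CubicForm.mem_of_pointSub_mem (S.baseChange (v : Place K).Completion)
    (O := S.mapPoints (v : Place K).Completion O)
    (N := (S.diagonalH0 Δ).range.comap 
      (AddMonoidHom.single (fun v : Δ => (S.baseChange (v : Place K).Completion).H0) v))
    (fun P => ?_) (D v)
  rw [AddSubgroup.mem_comap]
  -- Q has the class of P at v and that of O at the other places of Δ, so Q - O hits the generator
  -- [P] - [O] supported at v.
  obtain ⟨Q, hQ⟩ := happrox (Function.update (fun w => S.mapPoints (w : Place K).Completion O) v P)
  refine ⟨S.pointSub Q O, funext fun w => Subtype.ext ?_⟩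
  change (S.mapH0 (w : Place K).Completion (S.pointSub Q O) :
    (S.baseChange (w : Place K).Completion).H) = _
  rw [CubicForm.coe_mapH0_pointSub, hQ]
  by_cases hwv : w = v
  · subst hwv
    simp [CubicForm.pointSub]
  · simp [hwv]
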